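/- An instance of Many-To-One Matching consists of a finite set $U$ of students, a finite set $W$ of schools, for each student $u$ a nonempty strict preference list $\succ_u$ over a subset of the schools, for each school $w$ a nonempty strict priority order $\succ_w$ over a subset of the students, such that $w$ is in the list of $u$ if and only if $u$ is in the order of $w$ (we then call $u$ and $w$ acceptable to each other), and capacities $q(w)\ge 1$ for $w\in W$. A matching is a partial map $\mu$ from $U$ to $W$ that sends each matched student to a school acceptable to it; it is perfect if it is defined on all of $U$, and feasible if $|\mu^{-1}(w)|\le q(w)$ for all $w$. A student $u$ and a school $w$ that are acceptable to each other form a blocking pair if $u$ is unmatched or $w\succ_u\mu(u)$, and $|\mu^{-1}(w)|<q(w)$ or $u\succ_w u'$ for some $u'\in\mu^{-1}(w)$. A feasible matching is stable if it has no blocking pair. MinSumSP is the following problem: given such an instance with capacities $q$ and an integer $k^+\ge 1$, is there a vector $r\in\mathbb{Z}_{\ge 0}^{W}$ with $\sum_{w\in W} r(w)\le k^+$ such that the instance with capacities $q+r$ admits a stable and perfect matching? Multi-Colored Clique is the following problem: given an undirected graph $G=(V,E)$, an integer $h\ge 1$ and a partition $(V_1,\ldots,V_h)$ of $V$, does $G$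 contain a complete subgraph on $h$ vertices with exactly one vertex from each $V_i$? **Theorem.** MinSumSP is W[1]-hard with respect to the parameter $k^+$; that is, every parameterized problem in W[1] has a parameterized reduction to MinSumSP parameterized by $k^+$. Moreover, there is a polynomial-time parameterized reduction from Multi-Colored Clique, parameterized by $h$, to MinSumSP, parameterized by $k^+$, that maps each instance with parameter $h$ to an equivalent instance with $k^+=\binom{h}{2}+h$. Here W[1] is the class of all parameterized problems that have, for some constant $q$, a parameterized reduction to Weighted $q$-CNF-Satisfiability (given a CNF formula with at most $q$ literals per clause and the parameter $k$, is there a satisfying assignment that sets exactly $k$ variables to true?). A parameterized reduction maps $(x,k)$ in time $f(k)\cdot|x|^{O(1)}$ to an equivalent $(x',k')$ with $k'\le g(k)$, for computable functions $f,g$. -/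

import Mathlib

/-! ### A model of computation with a step count

Inputs and outputs are finite binary trees (S-expressions). Programs form a first-order language on
such trees. Every primitive is charged the full size of the tree it reads, so the cost of a run
bounds the size of every tree occurring in it; the model and Turing machines simulate each other
with polynomial overhead. -/

/-- Finite binary trees, the data on which programs work. -/
inductive SExp : Type
  | nil : SExp
  | cons : SExp → SExp → SExp

namespace SExp

/-- The number of nodes (including leaves). -/
def size : SExp → ℕ
  | nil => 1
  | cons a b => a.size + b.size + 1

/-- Lists of trees as trees. -/
def ofList : List SExp → SExp
  | [] => nil
  | a :: l => cons a (ofList l)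

/-- Natural numbers in unary. -/
def ofNat : ℕ → SExp
  | 0 => nil
  | n + 1 => cons nil (ofNat n)

/-- Truth values. -/
def ofBool : Bool → SExp
  | false => nil
  | true => cons nil nil

/-- Lists of natural numbers. -/
def ofNats (l : List ℕ) : SExp := ofList (l.map ofNat)

end SExp

/-- Programs. Each program transforms one tree into another one. -/
inductive Prog : Type
  /-- Constantly the leaf. -/
  | nil : Prog
  /-- The identity. -/
  | id : Prog
  /-- Left subtree. -/
  | hd : Prog
  /-- Right subtree. -/
  | tl : Prog
  /-- Run both programs on the input and join the results. -/
  | cons : Prog → Prog → Prog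
  /-- `seq f g`: first `f`, then `g`. -/
  | seq : Prog → Prog → Prog
  /-- `ite c f g`: run `f` if `c` returns a non-leaf on the input, otherwise run `g`. -/
  | ite : Prog → Prog → Prog → Prog
  /-- `loop c f`: as long as `c` returns a non-leaf on the current tree, transform it by `f`. -/
  | loop : Prog → Prog → Prog

/-- `Prog.Run p x y t`: on input `x`, the program `p` halts with output `y` after `t` steps. -/
inductive Prog.Run : Prog → SExp → SExp → ℕ → Prop
  | nil (x : SExp) : Run .nil x .nil x.size
  | id (x : SExp) : Run .id x x x.size
  | hd_nil : Run .hd .nil .nil SExp.nil.size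
  | hd_cons (a b : SExp) : Run .hd (.cons a b) a (SExp.cons a b).size
  | tl_nil : Run .tl .nil .nil SExp.nil.size
  | tl_cons (a b : SExp) : Run .tl (.cons a b) b (SExp.cons a b).size
  | cons {f g : Prog} {x a b : SExp} {s t : ℕ} :
      Run f x a s → Run g x b t → Run (.cons f g) x (.cons a b) (s + t + 1)
  | seq {f g : Prog} {x y z : SExp} {s t : ℕ} :
      Run f x y s → Run g y z t → Run (.seq f g) x z (s + t + 1)
  | ite_true {c f g : Prog} {x a b y : SExp} {s t : ℕ} :
      Run c x (.cons a b) s → Run f x y t → Run (.ite c f g) x y (s + t + 1)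
  | ite_false {c f g : Prog} {x y : SExp} {s t : ℕ} :
      Run c x .nil s → Run g x y t → Run (.ite c f g) x y (s + t + 1)
  | loop_stop {c f : Prog} {x : SExp} {s : ℕ} :
      Run c x .nil s → Run (.loop c f) x x (s + 1)
  | loop_step {c f : Prog} {x a b y z : SExp} {s t u : ℕ} :
      Run c x (.cons a b) s → Run f x y t → Run (.loop c f) y z u →
        Run (.loop c f) x z (s + t + u + 1)

/-! ### Parameterized problems and W[1] -/

/-- A parameterized decision problem: the set of its yes-instances `(x, k)`, where `x` is the input
and `k` the parameter. -/
abbrev ParamProblem : Type := Set (SExp × ℕ)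

/-- The tree on which a program working on `(x, k)` is started. -/
def paramInput (x : SExp) (k : ℕ) : SExp := .cons x (.ofNat k)

/-- Parameterized (many-one fpt-) reductions: a program maps `(x, k)` to an equivalent `(x', k')`
in at most `f k * |x| ^ e` steps, with `k' ≤ g k`, where `f` and `g` are computable. -/
def FPTReduces (P Q : ParamProblem) : Prop :=
  ∃ (p : Prog) (f g : ℕ → ℕ) (e : ℕ), Computable f ∧ Computable g ∧
    ∀ (x : SExp) (k : ℕ), ∃ (x' : SExp) (k' t : ℕ),
      p.Run (paramInput x k) (paramInput x' k') t ∧ t ≤ f k * x.size ^ e ∧ k' ≤ g k ∧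
        ((x, k) ∈ P ↔ (x', k') ∈ Q)

/-- A parameterized reduction that runs in polynomial time and maps every instance with parameter
`k` to an equivalent instance whose parameter is exactly `κ k`. -/
def PolyReducesWithParam (P Q : ParamProblem) (κ : ℕ → ℕ) : Prop :=
  ∃ (p : Prog) (a e : ℕ), ∀ (x : SExp) (k : ℕ), ∃ (x' : SExp) (t : ℕ),
    p.Run (paramInput x k) (paramInput x' (κ k)) t ∧ t ≤ a * (x.size + k) ^ e ∧
      ((x, k) ∈ P ↔ (x', κ k) ∈ Q)

/-- A formula in conjunctive normal form over the variables `0, …, n - 1`: a list of clauses, each a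
list of literals. The literal `(v, true)` is the variable `v`, and `(v, false)` is its negation. -/
abbrev CNFFormula (n : ℕ) : Type := List (List (Fin n × Bool))

namespace CNFFormula

/-- The assignment that sets exactly the variables in `S` to true satisfies `F`. -/
def SatisfiedBy {n : ℕ} (F : CNFFormula n) (S : Finset (Fin n)) : Prop :=
  ∀ C ∈ F, ∃ l ∈ C, (l.1 ∈ S ↔ l.2 = true)

/-- The formula, with its number of variables, as a tree. -/
def encode {n : ℕ} (F : CNFFormula n) : SExp :=
  .cons (.ofNat n) (.ofList (F.map fun C =>
    .ofList (C.map fun l => .cons (.ofNat l.1) (.ofBool l.2))))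

end CNFFormula

/-- Weighted `q`-CNF-Satisfiability: given a CNF formula with at most `q` literals per clause and the
parameter `k`, is there a satisfying assignment setting exactly `k` variables to true? -/
def WeightedCNFSat (q : ℕ) : ParamProblem :=
  {y | ∃ (n : ℕ) (F : CNFFormula n), y.1 = F.encode ∧ (∀ C ∈ F, C.length ≤ q) ∧
    ∃ S : Finset (Fin n), S.card = y.2 ∧ F.SatisfiedBy S}

/-- The class W[1]: the problems with a parameterized reduction to Weighted `q`-CNF-Satisfiability
for some constant `q`. -/
def W1 : Set ParamProblem := {P | ∃ q : ℕ, FPTReduces P (WeightedCNFSat q)}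

/-- W[1]-hardness: every problem in W[1] has a parameterized reduction to `Q`. -/
def W1Hard (Q : ParamProblem) : Prop := ∀ P ∈ W1, FPTReduces P Q

/-! ### Many-to-one matching -/

/-- An instance of Many-To-One Matching with students `U` and schools `W`. Preference lists and
priority orders are listed from most to least preferred. -/
structure MMInstance (U W : Type) where
  /-- preference list of a student -/
  pref : U → List W
  /-- priority order of a school -/
  prio : W → List U
  /-- capacities -/
  cap : W → ℕ
  pref_nodup : ∀ u, (pref u).Nodup
  prio_nodup : ∀ w, (prio w).Nodup
  pref_ne_nil : ∀ u, pref u ≠ []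
  prio_ne_nil : ∀ w, prio w ≠ []
  mem_pref_iff : ∀ u w, w ∈ pref u ↔ u ∈ prio w
  cap_pos : ∀ w, 0 < cap w

/-- In the duplicate-free list `l`, the element `a` comes strictly before `b`. -/
def Precedes {α : Type} (l : List α) (a b : α) : Prop := List.Sublist [a, b] l

namespace MMInstance

variable {U W : Type}

/-- The instance with capacities increased by `r`. -/
def increase (I : MMInstance U W) (r : W → ℕ) : MMInstance U W :=
  { I with
    cap := fun w => I.cap w + r w
    cap_pos := fun w => Nat.add_pos_left (I.cap_pos w) (r w) }

/-- `μ` assigns each student to an acceptable school or to none. -/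
def IsMatching (I : MMInstance U W) (μ : U → Option W) : Prop :=
  ∀ u w, μ u = some w → w ∈ I.pref u

/-- Every student is matched. -/
def IsPerfect (μ : U → Option W) : Prop := ∀ u, μ u ≠ none

/-- The number of students assigned to `w`. -/
def load [Fintype U] [DecidableEq W] (μ : U → Option W) (w : W) : ℕ :=
  (Finset.univ.filter fun u => μ u = some w).card

/-- No capacity is exceeded. -/
def IsFeasible [Fintype U] [DecidableEq W] (I : MMInstance U W) (μ : U → Option W) : Prop :=
  ∀ w, load μ w ≤ I.cap w

/-- The student `u` and the school `w` form a blocking pair in `μ`. -/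
def IsBlockingPair [Fintype U] [DecidableEq W] (I : MMInstance U W) (μ : U → Option W)
    (u : U) (w : W) : Prop :=
  u ∈ I.prio w ∧
  (μ u = none ∨ ∃ w', μ u = some w' ∧ Precedes (I.pref u) w w') ∧
  (load μ w < I.cap w ∨ ∃ u', μ u' = some w ∧ Precedes (I.prio w) u u')

/-- `μ` is a stable matching: it is a feasible matching without blocking pairs. -/
def IsStable [Fintype U] [DecidableEq W] (I : MMInstance U W) (μ : U → Option W) : Prop :=
  I.IsMatching μ ∧ I.IsFeasible μ ∧ ∀ u w, ¬ I.IsBlockingPair μ u w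

/-- Some capacity increase of total amount at most `k` admits a stable and perfect matching. -/
def HasSumSP [Fintype U] [Fintype W] [DecidableEq W] (I : MMInstance U W) (k : ℕ) : Prop :=
  ∃ r : W → ℕ, ∑ w, r w ≤ k ∧ ∃ μ : U → Option W, (I.increase r).IsStable μ ∧ IsPerfect μ

/-- Instances as trees: all preference lists, all priority orders, all capacities. -/
def encode {n m : ℕ} (I : MMInstance (Fin n) (Fin m)) : SExp :=
  .cons (.ofList (List.ofFn fun u => .ofNats ((I.pref u).map Fin.val)))
    (.cons (.ofList (List.ofFn fun w => .ofNats ((I.prio w).map Fin.val)))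
      (.ofNats (List.ofFn I.cap)))

end MMInstance

/-- MinSumSP, parameterized by the capacity bound (a positive integer). -/
def MinSumSP : ParamProblem :=
  {y | 0 < y.2 ∧ ∃ (n m : ℕ) (I : MMInstance (Fin n) (Fin m)), y.1 = I.encode ∧ I.HasSumSP y.2}

/-! ### Multi-Colored Clique -/

/-- An instance of Multi-Colored Clique with `h` colors: a vertex coloring (whose color classes form
the partition) and a list of edges. -/
structure MCCInstance (h : ℕ) where
  /-- number of vertices -/
  n : ℕ
  /-- the class containing a vertex -/
  color : Fin n → Fin h
  /-- list of edges, each given by its two endpoints -/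
  edges : List (Fin n × Fin n)
  edges_ne : ∀ e ∈ edges, e.1 ≠ e.2

namespace MCCInstance

variable {h : ℕ}

/-- The graph with the listed edges. -/
def graph (I : MCCInstance h) : SimpleGraph (Fin I.n) :=
  SimpleGraph.fromRel fun a b => (a, b) ∈ I.edges

/-- There is a clique on `h` vertices with exactly one vertex of each color. -/
def HasMultiColoredClique (I : MCCInstance h) : Prop :=
  ∃ S : Finset (Fin I.n), I.graph.IsNClique h S ∧ ∀ i : Fin h, ∃! v, v ∈ S ∧ I.color v = i

/-- Instances as trees: the colors of all vertices, then all edges. -/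
def encode (I : MCCInstance h) : SExp :=
  .cons (.ofNats (List.ofFn fun v => (I.color v : ℕ)))
    (.ofList (I.edges.map fun e => .cons (.ofNat e.1) (.ofNat e.2)))

end MCCInstance

/-- Multi-Colored Clique, parameterized by the number of colors (a positive integer). -/
def MultiColoredClique : ParamProblem :=
  {y | 0 < y.2 ∧ ∃ I : MCCInstance y.2, y.1 = I.encode ∧ I.HasMultiColoredClique}

/-!
Both claims rest on one reduction from Multi-Colored Clique to MinSumSP.

**From cliques to capacities.** A colored graph is turned into a matching instance in which every
school has one seat. A vertex `v` has two schools, a shelter and a home; an edge has one school. The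
student of `v` ranks the shelter of `v` first, the schools of the edges at `v` next, and the home of
`v` last. Shelters and schools of edges have a favorite student who accepts no other school. The
student of a color accepts the homes of the vertices of this color and has lower priority there than
the student of the vertex. The student of a pair of colors accepts the schools of the edges between
these colors and has the lowest priority there. There are `h.choose 2 + h` more students than
seats, so if that many seats are added and the matching is perfect, then no seat is free. If the
student of a pair of colors is at the school of an edge, then by stability the students of its
endpoints are not at home, and their homes, being full, are occupied by the students of their
colors. As the student of a color is in one place only, all edges chosen in this way join the
vertices chosen for the colors, which thus form a clique
(`MCCInstance.hasMultiColoredClique_of_hasSumSP`). Conversely, for a clique one adds a seat at the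
shelter of each of its vertices and at the school of each of its edges
(`MCCInstance.hasSumSP_of_hasMultiColoredClique`).

**From formulas to cliques.** For a formula whose clauses have at most `q` literals, a set of `k`
true variables is described by the values of the positions `1, …, k`. If a clause is violated, then
its negated variables are the values of a `q`-tuple of positions (position `0`, whose value is not a
variable, fills up the tuple). So there is a color for every position, whose vertices are the
possible values, and a color for every `q`-tuple of positions. A vertex of the latter consists of
values of these positions, together with a set of further bindings of positions to values that hits
every clause all of whose negated variables are among these values. Such sets of bindings are found
by a bounded search: of the first clause that is not yet hit, guess the positive variable that is
true, and its position. If the guesses are right, then `k` rounds suffice, and the number of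
sequences of guesses depends on `k` and `q` only. Vertices of different colors are adjacent if their
bindings are compatible (`CNFProgram.hasTransversal_of_finset`,
`CNFProgram.exists_finset_of_hasTransversal`).

**Running times.** `PolyTime f` says that some program computes `f` on encodings in polynomially
many steps. The class of these functions is closed under composition, case distinction and iteration
along a list as long as the intermediate states have polynomial size (`PolyTime.foldl`); this
covers the list operations from which both reductions are composed, so that `fun_prop` proves their
polynomial running time. The list of all sequences of guesses, which is not of polynomial size, is
computed from the parameter alone (`exists_runsIn_tuples`, `FPTReduces.of_polyTime`).
-/

/-! ### Data types encoded as trees, and programs computing on them -/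

/-- An encoding of the elements of a type as trees. It need not be injective. -/
class Enc (α : Type) where
  /-- the tree that represents an element -/
  enc : α → SExp

open Enc (enc)

instance : Enc SExp := ⟨fun x => x⟩
instance : Enc ℕ := ⟨SExp.ofNat⟩
instance : Enc Bool := ⟨SExp.ofBool⟩
instance {α β : Type} [Enc α] [Enc β] : Enc (α × β) := ⟨fun x => .cons (enc x.1) (enc x.2)⟩
instance {α : Type} [Enc α] : Enc (List α) := ⟨fun l => .ofList (l.map enc)⟩

/-- The size of the tree that represents an element. -/
def sz {α : Type} [Enc α] (a : α) : ℕ := (enc a).size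

section
variable {α β γ σ : Type} [Enc α] [Enc β] [Enc γ] [Enc σ]

theorem SExp.size_pos (x : SExp) : 0 < x.size := by
  cases x <;> simp [SExp.size]

theorem sz_pos (a : α) : 0 < sz a := SExp.size_pos _

theorem enc_pair (a : α) (b : β) : enc (a, b) = .cons (enc a) (enc b) := rfl

theorem enc_cons (a : α) (l : List α) : enc (a :: l) = .cons (enc a) (enc l) := rfl

@[simp] theorem sz_pair (a : α) (b : β) : sz (a, b) = sz a + sz b + 1 := rfl

@[simp] theorem sz_nil : sz ([] : List α) = 1 := rfl

@[simp] theorem sz_cons (a : α) (l : List α) : sz (a :: l) = sz a + sz l + 1 := rfl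

@[simp] theorem sz_nat (n : ℕ) : sz n = 2 * n + 1 := by
  change (SExp.ofNat n).size = _
  induction n with
  | zero => rfl
  | succ n ih => simp only [SExp.ofNat, SExp.size, ih]; ring

theorem sz_append (l₁ l₂ : List α) : sz (l₁ ++ l₂) + 1 = sz l₁ + sz l₂ := by
  induction l₁ with
  | nil => simp [add_comm]
  | cons a l ih => simp only [List.cons_append, sz_cons]; omega

theorem length_lt_sz (l : List α) : l.length < sz l := by
  induction l with
  | nil => simp
  | cons a l ih => simp only [List.length_cons, sz_cons]; omega

theorem sz_lt_of_mem {a : α} {l : List α} (h : a ∈ l) : sz a < sz l := by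
  induction l with
  | nil => simp at h
  | cons b l ih =>
    rcases List.mem_cons.1 h with rfl | h
    · simp only [sz_cons]; omega
    · have := ih h
      simp only [sz_cons]; omega

/-! ### Time bounds of single runs -/

theorem Prog.Run.size_input_le {p : Prog} {x y : SExp} {t : ℕ} (h : p.Run x y t) : x.size ≤ t := by
  induction h <;> omega

theorem Prog.Run.size_output_le {p : Prog} {x y : SExp} {t : ℕ} (h : p.Run x y t) : y.size ≤ t := by
  induction h with
  | nil x => exact SExp.size_pos x
  | hd_cons a b => simp only [SExp.size]; omega
  | tl_cons a b => simp only [SExp.size]; omega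
  | loop_stop h _ => have := h.size_input_le; omega
  | cons _ _ _ _ => simp only [SExp.size]; omega
  | _ => omega

/-- Some program computes `f` on encodings, and it takes at most `T a` steps on the input `a`. -/
def RunsIn (f : α → β) (T : α → ℕ) : Prop :=
  ∃ p : Prog, ∀ a, ∃ t ≤ T a, p.Run (enc a) (enc (f a)) t

theorem RunsIn.mono {f : α → β} {T T' : α → ℕ} (h : RunsIn f T) (hT : ∀ a, T a ≤ T' a) :
    RunsIn f T' := by
  obtain ⟨p, hp⟩ := h
  exact ⟨p, fun a => let ⟨t, ht, hr⟩ := hp a; ⟨t, ht.trans (hT a), hr⟩⟩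

theorem RunsIn.sz_le {f : α → β} {T : α → ℕ} (h : RunsIn f T) (a : α) : sz (f a) ≤ T a := by
  obtain ⟨p, hp⟩ := h
  obtain ⟨t, ht, hr⟩ := hp a
  exact hr.size_output_le.trans ht

/-- A function that leaves the encoding unchanged is computed by the identity program. -/
theorem RunsIn.of_enc_eq {f : α → β} (h : ∀ a, enc (f a) = enc a) : RunsIn f sz :=
  ⟨.id, fun a => ⟨_, le_rfl, by rw [h]; exact .id _⟩⟩

theorem RunsIn.comp {f : α → β} {g : β → γ} {Tf : α → ℕ} {Tg : β → ℕ} (hg : RunsIn g Tg)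
    (hf : RunsIn f Tf) : RunsIn (fun a => g (f a)) (fun a => Tf a + Tg (f a) + 1) := by
  obtain ⟨p, hp⟩ := hf
  obtain ⟨q, hq⟩ := hg
  refine ⟨.seq p q, fun a => ?_⟩
  obtain ⟨s, hs, hrs⟩ := hp a
  obtain ⟨t, ht, hrt⟩ := hq (f a)
  exact ⟨_, by beta_reduce; omega, .seq hrs hrt⟩

theorem RunsIn.pair {f : α → β} {g : α → γ} {Tf Tg : α → ℕ} (hf : RunsIn f Tf)
    (hg : RunsIn g Tg) : RunsIn (fun a => (f a, g a)) (fun a => Tf a + Tg a + 1) := by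
  obtain ⟨p, hp⟩ := hf
  obtain ⟨q, hq⟩ := hg
  refine ⟨.cons p q, fun a => ?_⟩
  obtain ⟨s, hs, hrs⟩ := hp a
  obtain ⟨t, ht, hrt⟩ := hq a
  exact ⟨_, by beta_reduce; omega, .cons hrs hrt⟩

theorem RunsIn.list_cons {f : α → β} {g : α → List β} {Tf Tg : α → ℕ} (hf : RunsIn f Tf)
    (hg : RunsIn g Tg) : RunsIn (fun a => f a :: g a) (fun a => Tf a + Tg a + 1) := hf.pair hg

theorem RunsIn.fst : RunsIn (Prod.fst : α × β → α) sz :=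
  ⟨.hd, fun _ => ⟨_, le_rfl, .hd_cons _ _⟩⟩

theorem RunsIn.snd : RunsIn (Prod.snd : α × β → β) sz :=
  ⟨.tl, fun _ => ⟨_, le_rfl, .tl_cons _ _⟩⟩

/-- The program that outputs a fixed tree. -/
def Prog.constant : SExp → Prog
  | .nil => .nil
  | .cons a b => .cons (constant a) (constant b)

theorem Prog.run_constant (y x : SExp) : ∃ t ≤ y.size * (x.size + 1), (constant y).Run x y t := by
  induction y with
  | nil => exact ⟨x.size, by simp [SExp.size], .nil x⟩
  | cons a b iha ihb =>
    obtain ⟨s, hs, hrs⟩ := iha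
    obtain ⟨t, ht, hrt⟩ := ihb
    refine ⟨_, ?_, .cons hrs hrt⟩
    simp only [SExp.size]
    nlinarith

theorem RunsIn.const (b : β) : RunsIn (fun _ : α => b) (fun a => sz b * (sz a + 1)) :=
  ⟨Prog.constant (enc b), fun a => Prog.run_constant (enc b) (enc a)⟩

theorem RunsIn.cond {c : α → Bool} {f g : α → β} {Tc Tf Tg : α → ℕ} (hc : RunsIn c Tc)
    (hf : RunsIn f Tf) (hg : RunsIn g Tg) :
    RunsIn (fun a => bif c a then f a else g a) (fun a => Tc a + Tf a + Tg a + 1) := by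
  obtain ⟨r, hr⟩ := hc
  obtain ⟨p, hp⟩ := hf
  obtain ⟨q, hq⟩ := hg
  refine ⟨.ite r p q, fun a => ?_⟩
  obtain ⟨u, hu, hru⟩ := hr a
  obtain ⟨s, hs, hrs⟩ := hp a
  obtain ⟨t, ht, hrt⟩ := hq a
  beta_reduce
  cases h : c a <;> rw [h] at hru
  · exact ⟨_, by omega, .ite_false hru hrt⟩
  · exact ⟨_, by omega, .ite_true hru hrs⟩

theorem RunsIn.headD {l : α → List β} {d : α → β} {Tl Td : α → ℕ} (hl : RunsIn l Tl)
    (hd : RunsIn d Td) :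
    RunsIn (fun a => (l a).headD (d a)) (fun a => 3 * Tl a + Td a + 2) := by
  obtain ⟨p, hp⟩ := hl
  obtain ⟨q, hq⟩ := hd
  refine ⟨.ite p (.seq p .hd) q, fun a => ?_⟩
  obtain ⟨s, hs, hrs⟩ := hp a
  obtain ⟨t, ht, hrt⟩ := hq a
  beta_reduce
  cases h : l a with
  | nil =>
    rw [h] at hrs
    exact ⟨_, by omega, .ite_false hrs hrt⟩
  | cons b l' =>
    rw [h] at hrs
    refine ⟨_, ?_, .ite_true hrs (.seq hrs (.hd_cons _ _))⟩
    have : (SExp.cons (enc b) (enc l')).size ≤ s := hrs.size_output_le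
    exact (by omega : s + (s + (SExp.cons (enc b) (enc l')).size + 1) + 1 ≤ 3 * Tl a + Td a + 2)

theorem RunsIn.tail : RunsIn (List.tail : List α → List α) sz := by
  refine ⟨.tl, fun l => ?_⟩
  cases l with
  | nil => exact ⟨_, le_rfl, .tl_nil⟩
  | cons a l => exact ⟨_, le_rfl, .tl_cons _ _⟩

theorem RunsIn.pred : RunsIn Nat.pred sz := by
  refine ⟨.tl, fun n => ?_⟩
  cases n with
  | zero => exact ⟨_, le_rfl, .tl_nil⟩
  | succ n => exact ⟨_, le_rfl, .tl_cons _ _⟩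

theorem RunsIn.isEmpty : RunsIn (List.isEmpty : List α → Bool) (fun l => 10 * sz l) := by
  refine ⟨.ite .id .nil (Prog.constant (SExp.ofBool true)), fun l => ?_⟩
  cases l with
  | nil =>
    obtain ⟨t, ht, hrt⟩ := Prog.run_constant (SExp.ofBool true) .nil
    refine ⟨_, ?_, .ite_false (.id _) hrt⟩
    have h1 : (SExp.ofBool true).size = 3 := rfl
    have h2 : SExp.nil.size = 1 := rfl
    rw [h1, h2] at ht
    change SExp.nil.size + t + 1 ≤ 10 * 1
    omega
  | cons a l =>
    refine ⟨_, ?_, .ite_true (.id _) (.nil _)⟩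
    change sz (a :: l) + sz (a :: l) + 1 ≤ _
    have := sz_pos (a :: l)
    beta_reduce
    omega

/-! ### Iteration along a list -/

/-- One round of the loop in `RunsIn.foldl`: it turns `(b :: l, a, s)` into `(l, a, s')`, where `s'`
is the output of `p` on `(a, s, b)`. -/
def Prog.foldStep (p : Prog) : Prog :=
  .cons (.seq .hd .tl) (.cons (.seq .tl .hd)
    (.seq (.cons (.seq .tl .hd) (.cons (.seq .tl .tl) (.seq .hd .hd))) p))

theorem Prog.run_foldStep {p : Prog} {a s b l s' : SExp} {t : ℕ}
    (h : p.Run (.cons a (.cons s b)) s' t) :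
    ∃ u ≤ 30 * (a.size + s.size + b.size + l.size + 1) + t,
      p.foldStep.Run (.cons (.cons b l) (.cons a s)) (.cons l (.cons a s')) u := by
  refine ⟨_, ?_, .cons (.seq (.hd_cons _ _) (.tl_cons _ _))
    (.cons (.seq (.tl_cons _ _) (.hd_cons _ _))
      (.seq (.cons (.seq (.tl_cons _ _) (.hd_cons _ _))
        (.cons (.seq (.tl_cons _ _) (.tl_cons _ _)) (.seq (.hd_cons _ _) (.hd_cons _ _)))) h))⟩
  simp only [SExp.size]
  omega

theorem Prog.run_fold_loop {p : Prog} {step : α × σ × β → σ} {a : α} {S D : ℕ} (l : List β) (s : σ)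
    (hS : ∀ l₁ l₂, l = l₁ ++ l₂ → sz (l₁.foldl (fun s b => step (a, s, b)) s) ≤ S)
    (hD : ∀ l₁ b l₂, l = l₁ ++ b :: l₂ →
      ∃ t ≤ D, p.Run (enc (a, l₁.foldl (fun s b => step (a, s, b)) s, b))
        (enc (step (a, l₁.foldl (fun s b => step (a, s, b)) s, b))) t) :
    ∃ t ≤ (l.length + 1) * (40 * (sz l + sz a + S + 1) + D),
      (Prog.loop .hd p.foldStep).Run (enc (l, a, s))
        (enc (([] : List β), a, l.foldl (fun s b => step (a, s, b)) s)) t := by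
  induction l generalizing s with
  | nil =>
    refine ⟨_, ?_, Prog.Run.loop_stop (.hd_cons _ _)⟩
    have h1 := hS [] [] rfl
    change sz (([] : List β), a, s) + 1 ≤ _
    simp only [sz_pair, sz_nil, List.foldl_nil, List.length_nil] at h1 ⊢
    omega
  | cons b l ih =>
    obtain ⟨t₁, ht₁, hr₁⟩ := hD [] b l rfl
    obtain ⟨t₂, ht₂, hr₂⟩ := Prog.run_foldStep (l := enc l) hr₁
    obtain ⟨t₃, ht₃, hr₃⟩ := ih (step (a, s, b))
      (fun l₁ l₂ h => hS (b :: l₁) l₂ (by rw [h, List.cons_append]))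
      (fun l₁ c l₂ h => hD (b :: l₁) c l₂ (by rw [h, List.cons_append]))
    refine ⟨_, ?_, .loop_step (.hd_cons _ _) hr₂ hr₃⟩
    have h1 : sz s ≤ S := hS [] _ rfl
    change t₂ ≤ 30 * (sz a + sz s + sz b + sz l + 1) + t₁ at ht₂
    change sz (b :: l, a, s) + t₂ + t₃ + 1 ≤ _
    simp only [sz_pair, sz_cons, List.length_cons] at *
    have h2 : (l.length + 1) * (40 * (sz l + sz a + S + 1) + D) ≤
        (l.length + 1) * (40 * (sz b + sz l + 1 + sz a + S + 1) + D) := by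
      gcongr; omega
    rw [add_mul _ 1, one_mul]
    omega

/-- Iteration along a list, with a bound `S` for the sizes of the intermediate states and a bound
`D` for the time of one iteration. -/
theorem RunsIn.foldl {l : α → List β} {i : α → σ} {step : α × σ × β → σ} {Tl Ti S D : α → ℕ}
    {Ts : α × σ × β → ℕ} (hl : RunsIn l Tl) (hi : RunsIn i Ti) (hs : RunsIn step Ts)
    (hS : ∀ a l₁ l₂, l a = l₁ ++ l₂ → sz (l₁.foldl (fun s b => step (a, s, b)) (i a)) ≤ S a)
    (hD : ∀ a l₁ b l₂, l a = l₁ ++ b :: l₂ →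
      Ts (a, l₁.foldl (fun s b => step (a, s, b)) (i a), b) ≤ D a) :
    RunsIn (fun a => (l a).foldl (fun s b => step (a, s, b)) (i a))
      (fun a => (Tl a + 2) * (40 * (Tl a + Ti a + sz a + S a + D a + 5))) := by
  obtain ⟨pl, hpl⟩ := hl
  obtain ⟨pi, hpi⟩ := hi
  obtain ⟨ps, hps⟩ := hs
  refine ⟨.seq (.seq (.cons pl (.cons .id pi)) (.loop .hd ps.foldStep)) (.seq .tl .tl),
    fun a => ?_⟩
  obtain ⟨t₁, ht₁, hr₁⟩ := hpl a
  obtain ⟨t₂, ht₂, hr₂⟩ := hpi a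
  obtain ⟨t₃, ht₃, hr₃⟩ := Prog.run_fold_loop (p := ps) (step := step) (l a) (i a) (hS a)
    (D := D a) (fun l₁ b l₂ h => by
      obtain ⟨t, ht, hr⟩ := hps (a, l₁.foldl (fun s b => step (a, s, b)) (i a), b)
      exact ⟨t, ht.trans (hD a l₁ b l₂ h), hr⟩)
  refine ⟨_, ?_, .seq (.seq (.cons hr₁ (.cons (.id _) hr₂)) hr₃)
    (.seq (.tl_cons _ _) (.tl_cons _ _))⟩
  have h1 : sz (l a) ≤ t₁ := hr₁.size_output_le
  have h2 := hS a (l a) [] (by simp)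
  have h3 := length_lt_sz (l a)
  have h4 : ((l a).length + 1) * (40 * (sz (l a) + sz a + S a + 1) + D a) ≤
      (Tl a) * (40 * (Tl a + sz a + S a + 1) + D a) := by
    gcongr <;> omega
  change t₁ + (sz a + t₂ + 1) + 1 + t₃ + 1 + (sz (([] : List β), a,
    (l a).foldl (fun s b => step (a, s, b)) (i a)) + sz (a,
    (l a).foldl (fun s b => step (a, s, b)) (i a)) + 1) + 1 ≤ _
  simp only [sz_pair, sz_nil]
  have h5 : (Tl a) * (40 * (Tl a + sz a + S a + 1) + D a) ≤
      (Tl a) * (40 * (Tl a + Ti a + sz a + S a + D a + 5)) := by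
    gcongr; omega
  rw [add_mul _ 2]
  omega

end

/-! ### Polynomial time -/

section
variable {α β γ δ σ : Type} [Enc α] [Enc β] [Enc γ] [Enc δ] [Enc σ]

theorem Polynomial.eval_le_eval_of_le (P : Polynomial ℕ) {m n : ℕ} (h : m ≤ n) :
    P.eval m ≤ P.eval n := by
  simp only [Polynomial.eval_eq_sum_range]
  gcongr

/-- The function `T` is bounded by a polynomial in the size of its argument. -/
def PolyBdd (T : α → ℕ) : Prop := ∃ P : Polynomial ℕ, ∀ a, T a ≤ P.eval (sz a)

theorem PolyBdd.mono {T T' : α → ℕ} (h : PolyBdd T) (hT : ∀ a, T' a ≤ T a) : PolyBdd T' := by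
  obtain ⟨P, hP⟩ := h
  exact ⟨P, fun a => (hT a).trans (hP a)⟩

theorem PolyBdd.size : PolyBdd (sz : α → ℕ) := ⟨.X, by simp⟩

theorem PolyBdd.const (c : ℕ) : PolyBdd (fun _ : α => c) := ⟨.C c, by simp⟩

theorem PolyBdd.add {S T : α → ℕ} (hS : PolyBdd S) (hT : PolyBdd T) :
    PolyBdd (fun a => S a + T a) := by
  obtain ⟨P, hP⟩ := hS
  obtain ⟨Q, hQ⟩ := hT
  exact ⟨P + Q, fun a => by rw [Polynomial.eval_add]; exact add_le_add (hP a) (hQ a)⟩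

theorem PolyBdd.mul {S T : α → ℕ} (hS : PolyBdd S) (hT : PolyBdd T) :
    PolyBdd (fun a => S a * T a) := by
  obtain ⟨P, hP⟩ := hS
  obtain ⟨Q, hQ⟩ := hT
  exact ⟨P * Q, fun a => by rw [Polynomial.eval_mul]; exact Nat.mul_le_mul (hP a) (hQ a)⟩

theorem PolyBdd.comp {T : β → ℕ} {f : α → β} (hT : PolyBdd T) (hf : PolyBdd fun a => sz (f a)) :
    PolyBdd (fun a => T (f a)) := by
  obtain ⟨P, hP⟩ := hT
  obtain ⟨Q, hQ⟩ := hf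
  refine ⟨P.comp Q, fun a => (hP _).trans ?_⟩
  rw [Polynomial.eval_comp]
  exact P.eval_le_eval_of_le (hQ a)

/-- The function `f` is computable in polynomial time. -/
@[fun_prop]
def PolyTime (f : α → β) : Prop := ∃ T : α → ℕ, PolyBdd T ∧ RunsIn f T

theorem PolyTime.polyBdd_sz {f : α → β} (hf : PolyTime f) : PolyBdd (fun a => sz (f a)) := by
  obtain ⟨T, hT, hr⟩ := hf
  exact hT.mono hr.sz_le

theorem PolyBdd.comp_poly {T : β → ℕ} {f : α → β} (hT : PolyBdd T) (hf : PolyTime f) :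
    PolyBdd (fun a => T (f a)) := hT.comp hf.polyBdd_sz

theorem PolyTime.congr {f g : α → β} (hf : PolyTime f) (h : ∀ a, f a = g a) : PolyTime g :=
  funext h ▸ hf

theorem PolyTime.of_enc_eq {f : α → β} (h : ∀ a, enc (f a) = enc a) : PolyTime f :=
  ⟨_, .size, .of_enc_eq h⟩

@[fun_prop]
theorem PolyTime.id : PolyTime (fun a : α => a) := .of_enc_eq fun _ => rfl

@[fun_prop]
theorem PolyTime.const (b : β) : PolyTime (fun _ : α => b) :=
  ⟨_, .mul (.const _) (.add .size (.const 1)), .const b⟩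

@[fun_prop]
theorem PolyTime.comp {g : β → γ} {f : α → β} (hg : PolyTime g) (hf : PolyTime f) :
    PolyTime (fun a => g (f a)) := by
  have hf' := hf
  obtain ⟨T, hT, hr⟩ := hf
  obtain ⟨S, hS, hq⟩ := hg
  exact ⟨_, .add (.add hT (hS.comp_poly hf')) (.const 1), hq.comp hr⟩

@[fun_prop]
theorem PolyTime.prodMk {f : α → β} {g : α → γ} (hf : PolyTime f) (hg : PolyTime g) :
    PolyTime (fun a => (f a, g a)) := by
  obtain ⟨T, hT, hr⟩ := hf
  obtain ⟨S, hS, hq⟩ := hg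
  exact ⟨_, .add (.add hT hS) (.const 1), hr.pair hq⟩

@[fun_prop]
theorem PolyTime.fst {f : α → β × γ} (hf : PolyTime f) : PolyTime (fun a => (f a).1) :=
  PolyTime.comp ⟨_, .size, .fst⟩ hf

@[fun_prop]
theorem PolyTime.snd {f : α → β × γ} (hf : PolyTime f) : PolyTime (fun a => (f a).2) :=
  PolyTime.comp ⟨_, .size, .snd⟩ hf

@[fun_prop]
theorem PolyTime.cond {c : α → Bool} {f g : α → β} (hc : PolyTime c) (hf : PolyTime f)
    (hg : PolyTime g) :
    PolyTime (fun a => bif c a then f a else g a) := by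
  obtain ⟨T, hT, hr⟩ := hc
  obtain ⟨S, hS, hq⟩ := hf
  obtain ⟨U, hU, hs⟩ := hg
  exact ⟨_, .add (.add (.add hT hS) hU) (.const 1), hr.cond hq hs⟩

@[fun_prop]
theorem PolyTime.cons {f : α → β} {g : α → List β} (hf : PolyTime f) (hg : PolyTime g) :
    PolyTime (fun a => f a :: g a) := by
  obtain ⟨T, hT, hr⟩ := hf
  obtain ⟨S, hS, hq⟩ := hg
  exact ⟨_, .add (.add hT hS) (.const 1), hr.list_cons hq⟩

@[fun_prop]
theorem PolyTime.headD {l : α → List β} {d : α → β} (hl : PolyTime l) (hd : PolyTime d) :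
    PolyTime (fun a => (l a).headD (d a)) := by
  obtain ⟨T, hT, hr⟩ := hl
  obtain ⟨S, hS, hq⟩ := hd
  exact ⟨_, .add (.add (.mul (.const 3) hT) hS) (.const 2), hr.headD hq⟩

@[fun_prop]
theorem PolyTime.tail {l : α → List β} (hl : PolyTime l) : PolyTime (fun a => (l a).tail) :=
  PolyTime.comp ⟨_, .size, .tail⟩ hl

@[fun_prop]
theorem PolyTime.isEmpty {l : α → List β} (hl : PolyTime l) : PolyTime (fun a => (l a).isEmpty) :=
  PolyTime.comp ⟨_, .mul (.const 10) .size, .isEmpty⟩ hl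

/-- Iteration along a list takes polynomial time if the intermediate states have polynomial size. -/
theorem PolyTime.foldl {l : α → List β} {i : α → σ} {step : α → σ → β → σ} {S : α → ℕ}
    (hl : PolyTime l) (hi : PolyTime i) (hs : PolyTime fun x : α × σ × β => step x.1 x.2.1 x.2.2)
    (hS : PolyBdd S)
    (h : ∀ a l₁ l₂, l a = l₁ ++ l₂ → sz (l₁.foldl (step a) (i a)) ≤ S a) :
    PolyTime (fun a => (l a).foldl (step a) (i a)) := by
  obtain ⟨Tl, hTl, hrl⟩ := hl
  obtain ⟨Ti, hTi, hri⟩ := hi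
  obtain ⟨Ts, ⟨P, hP⟩, hrs⟩ := hs
  have hB : PolyBdd (fun a : α => P.eval (sz a + S a + Tl a + 2)) := by
    obtain ⟨Q, hQ⟩ := ((PolyBdd.size.add hS).add hTl).add (.const 2)
    refine ⟨P.comp Q, fun a => ?_⟩
    rw [Polynomial.eval_comp]
    exact P.eval_le_eval_of_le (hQ a)
  refine ⟨_, ?_, hrl.foldl hri hrs h (D := fun a => P.eval (sz a + S a + Tl a + 2))
    fun a l₁ b l₂ hab => (hP _).trans (P.eval_le_eval_of_le ?_)⟩
  · exact (hTl.add (.const 2)).mul ((PolyBdd.const 40).mul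
      (((((hTl.add hTi).add .size).add hS).add hB).add (.const 5)))
  · have h1 := h a l₁ _ hab
    have h2 : sz b < sz (l a) := sz_lt_of_mem (by simp [hab])
    have h3 := hrl.sz_le a
    change sz a + (sz (l₁.foldl (step a) (i a)) + sz b + 1) + 1 ≤ _
    omega

/-- Iteration along a list takes polynomial time if every step increases the size of the state by a
polynomial amount at most. -/
theorem PolyTime.foldl_of_le_add {l : α → List β} {i : α → σ} {step : α → σ → β → σ} {D : α → ℕ}
    (hl : PolyTime l) (hi : PolyTime i) (hs : PolyTime fun x : α × σ × β => step x.1 x.2.1 x.2.2)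
    (hD : PolyBdd D) (h : ∀ a s, ∀ b ∈ l a, sz (step a s b) ≤ sz s + D a) :
    PolyTime (fun a => (l a).foldl (step a) (i a)) := by
  refine hl.foldl hi hs (hi.polyBdd_sz.add (hl.polyBdd_sz.mul hD)) fun a l₁ l₂ hab => ?_
  have key : ∀ l₁ : List β, l₁ ⊆ l a → ∀ s,
      sz (l₁.foldl (step a) s) ≤ sz s + l₁.length * D a := by
    intro l₁
    induction l₁ with
    | nil => intro _ s; simp
    | cons b l ih =>
      intro hb s
      have h1 := ih (fun x hx => hb (List.mem_cons_of_mem _ hx)) (step a s b)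
      have h2 := h a s b (hb List.mem_cons_self)
      rw [List.foldl_cons, List.length_cons, add_mul]
      omega
  refine (key l₁ (by simp [hab]) _).trans ?_
  have h1 := length_lt_sz (l a)
  have h2 : l₁.length ≤ (l a).length := by simp [hab]
  gcongr
  omega

/-! #### Lists -/

@[fun_prop]
theorem PolyTime.reverse {l : α → List β} (hl : PolyTime l) :
    PolyTime (fun a => (l a).reverse) := by
  have : PolyTime (fun a => (l a).foldl (fun s b => b :: s) []) :=
    hl.foldl_of_le_add (by fun_prop) (by fun_prop) (hl.polyBdd_sz.add (.const 1))
      fun a s b hb => by have := sz_lt_of_mem hb; rw [sz_cons]; omega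
  simpa using this

@[fun_prop]
theorem PolyTime.append {l₁ l₂ : α → List β} (hl₁ : PolyTime l₁) (hl₂ : PolyTime l₂) :
    PolyTime (fun a => l₁ a ++ l₂ a) := by
  have : PolyTime (fun a => (l₁ a).reverse.foldl (fun s b => b :: s) (l₂ a)) :=
    hl₁.reverse.foldl_of_le_add hl₂ (by fun_prop) (hl₁.polyBdd_sz.add (.const 1))
      fun a s b hb => by
        have := sz_lt_of_mem (List.mem_reverse.1 hb)
        rw [sz_cons]; omega
  simpa using this

@[fun_prop]
theorem PolyTime.map {l : α → List β} {f : α → β → γ} (hl : PolyTime l)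
    (hf : PolyTime fun x : α × β => f x.1 x.2) : PolyTime (fun a => (l a).map (f a)) := by
  obtain ⟨P, hP⟩ := hf.polyBdd_sz
  have hB : PolyBdd (fun a : α => P.eval (sz a + sz (l a) + 1) + 1) := by
    obtain ⟨Q, hQ⟩ := (PolyBdd.size.add hl.polyBdd_sz).add (.const 1)
    refine PolyBdd.add ⟨P.comp Q, fun a => ?_⟩ (.const 1)
    rw [Polynomial.eval_comp]
    exact P.eval_le_eval_of_le (hQ a)
  have : PolyTime (fun a => ((l a).foldl (fun s b => f a b :: s) []).reverse) := by
    refine .reverse (hl.foldl_of_le_add (by fun_prop) ?_ hB fun a s b hb => ?_)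
    · exact PolyTime.cons
        (PolyTime.comp hf (f := fun x : α × List γ × β => (x.1, x.2.2)) (by fun_prop))
        (by fun_prop)
    · have h1 := hP (a, b)
      have h2 := sz_lt_of_mem hb
      have h3 := P.eval_le_eval_of_le (show sz (a, b) ≤ sz a + sz (l a) + 1 by simp; omega)
      rw [sz_cons]
      dsimp only at h1
      omega
  have key : ∀ a (l : List β) s,
      l.foldl (fun s b => f a b :: s) s = (l.map (f a)).reverse ++ s := by
    intro a l
    induction l with
    | nil => simp
    | cons b l ih => intro s; simp [ih]
  simpa [key] using this

@[fun_prop]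
theorem PolyTime.flatten {l : α → List (List β)} (hl : PolyTime l) :
    PolyTime (fun a => (l a).flatten) := by
  have : PolyTime (fun a => (l a).foldl (fun s b => s ++ b) []) :=
    hl.foldl_of_le_add (by fun_prop) (by fun_prop) hl.polyBdd_sz
      fun a s b hb => by have := sz_lt_of_mem hb; have := sz_append s b; omega
  have key : ∀ (l : List (List β)) s, l.foldl (fun s b => s ++ b) s = s ++ l.flatten := by
    intro l
    induction l with
    | nil => simp
    | cons b l ih => intro s; simp [ih]
  simpa [key] using this

@[fun_prop]
theorem PolyTime.flatMap {l : α → List β} {f : α → β → List γ} (hl : PolyTime l)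
    (hf : PolyTime fun x : α × β => f x.1 x.2) : PolyTime (fun a => (l a).flatMap (f a)) := by
  simpa only [List.flatMap_def] using (hl.map hf).flatten

@[fun_prop]
theorem PolyTime.filter {l : α → List β} {f : α → β → Bool} (hl : PolyTime l)
    (hf : PolyTime fun x : α × β => f x.1 x.2) : PolyTime (fun a => (l a).filter (f a)) := by
  have : PolyTime (fun a => (l a).flatMap fun b => bif f a b then [b] else []) := by fun_prop
  have key : ∀ a (l : List β),
      l.flatMap (fun b => bif f a b then [b] else []) = l.filter (f a) := by
    intro a l
    induction l with
    | nil => rfl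
    | cons b l ih => cases h : f a b <;> simp [h] <;> simpa using ih
  simpa only [key] using this

/-! #### Truth values and numbers -/

@[fun_prop]
theorem PolyTime.not {p : α → Bool} (hp : PolyTime p) : PolyTime (fun a => !p a) := by
  have : PolyTime (fun a => bif p a then false else true) := by fun_prop
  exact this.congr fun a => by cases p a <;> rfl

@[fun_prop]
theorem PolyTime.and {p q : α → Bool} (hp : PolyTime p) (hq : PolyTime q) :
    PolyTime (fun a => p a && q a) := by
  have : PolyTime (fun a => bif p a then q a else false) := by fun_prop
  exact this.congr fun a => by cases p a <;> rfl

@[fun_prop]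
theorem PolyTime.or {p q : α → Bool} (hp : PolyTime p) (hq : PolyTime q) :
    PolyTime (fun a => p a || q a) := by
  have : PolyTime (fun a => bif p a then true else q a) := by fun_prop
  exact this.congr fun a => by cases p a <;> rfl

@[fun_prop]
theorem PolyTime.all {l : α → List β} {p : α → β → Bool} (hl : PolyTime l)
    (hp : PolyTime fun x : α × β => p x.1 x.2) : PolyTime (fun a => (l a).all (p a)) := by
  have : PolyTime (fun a => ((l a).filter fun b => !p a b).isEmpty) := by fun_prop
  have key : ∀ a, ((l a).filter fun b => !p a b).isEmpty = (l a).all (p a) := by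
    intro a
    rw [Bool.eq_iff_iff]
    simp
  simpa only [key] using this

@[fun_prop]
theorem PolyTime.any {l : α → List β} {p : α → β → Bool} (hl : PolyTime l)
    (hp : PolyTime fun x : α × β => p x.1 x.2) : PolyTime (fun a => (l a).any (p a)) := by
  have : PolyTime (fun a => !(l a).all fun b => !p a b) := by fun_prop
  simpa [List.not_all_eq_any_not] using this

theorem enc_replicate (n : ℕ) : enc (List.replicate n SExp.nil) = enc n := by
  induction n with
  | zero => rfl
  | succ n ih => rw [List.replicate_succ, enc_cons, ih]; rfl

@[fun_prop]
theorem PolyTime.replicate_nil {n : α → ℕ} (hn : PolyTime n) :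
    PolyTime (fun a => List.replicate (n a) SExp.nil) :=
  PolyTime.comp (PolyTime.of_enc_eq enc_replicate) hn

@[fun_prop]
theorem PolyTime.succ {n : α → ℕ} (hn : PolyTime n) : PolyTime (fun a => n a + 1) :=
  PolyTime.comp (g := fun n : ℕ => n + 1)
    ⟨_, .add (.add .size .size) (.const 1), .cons .nil .id,
      fun _ => ⟨_, le_rfl, .cons (.nil _) (.id _)⟩⟩ hn

@[fun_prop]
theorem PolyTime.pred {n : α → ℕ} (hn : PolyTime n) : PolyTime (fun a => (n a).pred) :=
  PolyTime.comp ⟨_, .size, .pred⟩ hn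

@[fun_prop]
theorem PolyTime.add {m n : α → ℕ} (hm : PolyTime m) (hn : PolyTime n) :
    PolyTime (fun a => m a + n a) := by
  have : PolyTime (fun a => (List.replicate (n a) SExp.nil).foldl (fun s _ => s + 1) (m a)) :=
    hn.replicate_nil.foldl_of_le_add hm (by fun_prop) (.const 2) fun a s b _ => by
      simp only [sz_nat]; omega
  have key : ∀ n s, (List.replicate n SExp.nil).foldl (fun s _ => s + 1) s = s + n := by
    intro n
    induction n with
    | zero => simp
    | succ n ih => intro s; rw [List.replicate_succ, List.foldl_cons, ih]; ring
  simpa only [key] using this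

@[fun_prop]
theorem PolyTime.sub {m n : α → ℕ} (hm : PolyTime m) (hn : PolyTime n) :
    PolyTime (fun a => m a - n a) := by
  have : PolyTime (fun a => (List.replicate (n a) SExp.nil).foldl (fun s _ => s.pred) (m a)) :=
    hn.replicate_nil.foldl_of_le_add hm (by fun_prop) (.const 0) fun a s b _ => by
      simp only [sz_nat]; have := Nat.pred_le s; omega
  have key : ∀ n s, (List.replicate n SExp.nil).foldl (fun s _ => s.pred) s = s - n := by
    intro n
    induction n with
    | zero => simp
    | succ n ih =>
      intro s
      rw [List.replicate_succ, List.foldl_cons, ih, Nat.pred_eq_sub_one]; omega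
  simpa only [key] using this

@[fun_prop]
theorem PolyTime.decide_le {m n : α → ℕ} (hm : PolyTime m) (hn : PolyTime n) :
    PolyTime (fun a => decide (m a ≤ n a)) := by
  have : PolyTime (fun a => (List.replicate (m a - n a) SExp.nil).isEmpty) := by fun_prop
  have key : ∀ a, (List.replicate (m a - n a) SExp.nil).isEmpty = decide (m a ≤ n a) := by
    intro a
    rw [Bool.eq_iff_iff]
    simp [Nat.sub_eq_zero_iff_le]
  simpa only [key] using this

@[fun_prop]
theorem PolyTime.decide_lt {m n : α → ℕ} (hm : PolyTime m) (hn : PolyTime n) :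
    PolyTime (fun a => decide (m a < n a)) := by
  have : PolyTime (fun a => decide (m a + 1 ≤ n a)) := by fun_prop
  exact this

@[fun_prop]
theorem PolyTime.decide_eq {m n : α → ℕ} (hm : PolyTime m) (hn : PolyTime n) :
    PolyTime (fun a => decide (m a = n a)) := by
  have : PolyTime (fun a => decide (m a ≤ n a) && decide (n a ≤ m a)) := by fun_prop
  simpa only [← Bool.decide_and, ← le_antisymm_iff] using this

@[fun_prop]
theorem PolyTime.length {l : α → List β} (hl : PolyTime l) : PolyTime (fun a => (l a).length) := by
  have : PolyTime (fun a => (l a).foldl (fun s _ => s + 1) 0) :=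
    hl.foldl_of_le_add (by fun_prop) (by fun_prop) (.const 2) fun a s b _ => by
      simp only [sz_nat]; omega
  simpa using this

@[fun_prop]
theorem PolyTime.range {n : α → ℕ} (hn : PolyTime n) : PolyTime (fun a => List.range (n a)) := by
  have key : ∀ n, (List.replicate n SExp.nil).foldl (fun s _ => s ++ [s.length]) [] =
      List.range n := by
    intro n
    induction n with
    | zero => simp
    | succ n ih =>
      rw [List.replicate_succ', List.foldl_append, ih, List.range_succ]
      simp
  have hsz : ∀ n, sz (List.range n) ≤ (2 * n + 2) * (2 * n + 2) := by
    intro n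
    induction n with
    | zero => simp
    | succ n ih =>
      have := sz_append (List.range n) [n]
      rw [List.range_succ]
      simp only [sz_cons, sz_nat, sz_nil] at this
      nlinarith
  have : PolyTime (fun a =>
      (List.replicate (n a) SExp.nil).foldl (fun s _ => s ++ [s.length]) []) := by
    refine hn.replicate_nil.foldl (by fun_prop) (by fun_prop)
      ((hn.polyBdd_sz.add (.const 2)).mul (hn.polyBdd_sz.add (.const 2))) fun a l₁ l₂ h => ?_
    obtain ⟨hlen, h₁, -⟩ := List.append_eq_replicate_iff.1 h.symm
    rw [h₁, key]
    refine (hsz _).trans ?_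
    rw [sz_nat]
    gcongr <;> omega
  simpa only [key] using this

@[fun_prop]
theorem PolyTime.drop {n : α → ℕ} {l : α → List β} (hn : PolyTime n) (hl : PolyTime l) :
    PolyTime (fun a => (l a).drop (n a)) := by
  have : PolyTime (fun a => (List.replicate (n a) SExp.nil).foldl (fun s _ => s.tail) (l a)) :=
    hn.replicate_nil.foldl_of_le_add hl (by fun_prop) (.const 0) fun a s b _ => by
      cases s <;> simp; omega
  have key : ∀ n (s : List β),
      (List.replicate n SExp.nil).foldl (fun s _ => s.tail) s = s.drop n := by
    intro n
    induction n with
    | zero => simp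
    | succ n ih => intro s; rw [List.replicate_succ, List.foldl_cons, ih]; simp
  simpa only [key] using this

@[fun_prop]
theorem PolyTime.getD {l : α → List β} {n : α → ℕ} {d : α → β} (hl : PolyTime l) (hn : PolyTime n)
    (hd : PolyTime d) : PolyTime (fun a => (l a).getD (n a) (d a)) := by
  have : PolyTime (fun a => ((l a).drop (n a)).headD (d a)) := by fun_prop
  simpa [List.getD_eq_getElem?_getD] using this

@[fun_prop]
theorem PolyTime.decide_mem {l : α → List ℕ} {n : α → ℕ} (hl : PolyTime l) (hn : PolyTime n) :
    PolyTime (fun a => decide (n a ∈ l a)) := by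
  have : PolyTime (fun a => (l a).any fun m => decide (m = n a)) := by fun_prop
  exact this.congr fun a => by rw [Bool.eq_iff_iff]; simp

/-! #### Reading trees as data -/

/-- Every tree is the encoding of a list of trees. -/
def SExp.toList : SExp → List SExp
  | nil => []
  | cons a b => a :: b.toList

theorem SExp.enc_toList (x : SExp) : enc x.toList = x := by
  induction x with
  | nil => rfl
  | cons a b _ ih => rw [toList, enc_cons, ih]; rfl

theorem SExp.toList_enc (l : List α) : (enc l).toList = l.map enc := by
  induction l with
  | nil => rfl
  | cons a l ih => rw [enc_cons, toList, ih]; rfl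

/-- The root of the left subtree, and a leaf for a leaf. -/
def SExp.left : SExp → SExp
  | nil => nil
  | cons a _ => a

/-- The root of the right subtree, and a leaf for a leaf. -/
def SExp.right : SExp → SExp
  | nil => nil
  | cons _ b => b

/-- The number that a tree encodes; for other trees, the number of right turns from the root. -/
def SExp.toNat (x : SExp) : ℕ := x.toList.length

/-- Whether a tree encodes a number. -/
def SExp.isNat (x : SExp) : Bool := x.toList.all fun y => y.toList.isEmpty

@[fun_prop]
theorem PolyTime.toList {f : α → SExp} (hf : PolyTime f) : PolyTime (fun a => (f a).toList) :=
  PolyTime.comp (.of_enc_eq SExp.enc_toList) hf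

@[fun_prop]
theorem PolyTime.left {f : α → SExp} (hf : PolyTime f) : PolyTime (fun a => (f a).left) := by
  have : PolyTime (fun a => (f a).toList.headD .nil) := by fun_prop
  exact this.congr fun a => by cases f a <;> rfl

@[fun_prop]
theorem PolyTime.right {f : α → SExp} (hf : PolyTime f) : PolyTime (fun a => (f a).right) := by
  have h : PolyTime (fun x : SExp => x.right) := by
    refine ⟨_, .size, .tl, fun x => ?_⟩
    cases x with
    | nil => exact ⟨_, le_rfl, .tl_nil⟩
    | cons a b => exact ⟨_, le_rfl, .tl_cons _ _⟩
  exact h.comp hf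

@[fun_prop]
theorem PolyTime.toNat {f : α → SExp} (hf : PolyTime f) : PolyTime (fun a => (f a).toNat) := by
  unfold SExp.toNat; fun_prop

@[fun_prop]
theorem PolyTime.isNat {f : α → SExp} (hf : PolyTime f) : PolyTime (fun a => (f a).isNat) := by
  unfold SExp.isNat; fun_prop

/-- A polynomial-time function into lists or numbers can be read as one into trees. -/
@[fun_prop]
theorem PolyTime.enc {f : α → β} (hf : PolyTime f) : PolyTime (fun a => Enc.enc (f a)) :=
  PolyTime.comp (.of_enc_eq fun _ => rfl) hf

@[simp]
theorem SExp.toNat_enc (n : ℕ) : (Enc.enc n).toNat = n := by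
  rw [← enc_replicate, toNat, toList_enc]; simp

@[simp]
theorem SExp.isNat_enc (n : ℕ) : (Enc.enc n).isNat = true := by
  rw [← enc_replicate, isNat, toList_enc]; simp [Enc.enc, toList]

theorem SExp.enc_toNat {x : SExp} (h : x.isNat = true) : Enc.enc x.toNat = x := by
  have : x.toList = List.replicate x.toNat .nil := by
    refine List.eq_replicate_iff.2 ⟨rfl, fun y hy => ?_⟩
    have := List.all_eq_true.1 h y hy
    cases y with
    | nil => rfl
    | cons a b => simp [toList] at this
  rw [← enc_replicate, ← this, enc_toList]

theorem SExp.left_enc (x : α × β) : (Enc.enc x).left = Enc.enc x.1 := rfl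

theorem SExp.right_enc (x : α × β) : (Enc.enc x).right = Enc.enc x.2 := rfl

end

/-! ### Computable bounds and reductions -/

theorem Polynomial.exists_eval_le_mul_pow (P : Polynomial ℕ) :
    ∃ c e : ℕ, ∀ n, 0 < n → P.eval n ≤ c * n ^ e := by
  induction P using Polynomial.induction_on' with
  | add p q hp hq =>
    obtain ⟨c, e, h⟩ := hp
    obtain ⟨c', e', h'⟩ := hq
    refine ⟨c + c', e + e', fun n hn => ?_⟩
    rw [Polynomial.eval_add, add_mul]
    have h1 : n ^ e ≤ n ^ (e + e') := Nat.pow_le_pow_right hn (by omega)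
    have h2 : n ^ e' ≤ n ^ (e + e') := Nat.pow_le_pow_right hn (by omega)
    exact add_le_add ((h n hn).trans (by gcongr)) ((h' n hn).trans (by gcongr))
  | monomial e c => exact ⟨c, e, fun n _ => by rw [Polynomial.eval_monomial]⟩

theorem Computable.add_nat {f g : ℕ → ℕ} (hf : Computable f) (hg : Computable g) :
    Computable fun n => f n + g n := (Primrec.nat_add.to_comp).comp hf hg

theorem Computable.mul_nat {f g : ℕ → ℕ} (hf : Computable f) (hg : Computable g) :
    Computable fun n => f n * g n := (Primrec.nat_mul.to_comp).comp hf hg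

theorem Computable.pow_nat {f g : ℕ → ℕ} (hf : Computable f) (hg : Computable g) :
    Computable fun n => f n ^ g n := by
  have : Computable fun n =>
      Nat.rec (motive := fun _ => ℕ) 1 (fun _ r => r * f n) (g n) :=
    Computable.nat_rec hg (.const 1)
      (Computable.to₂ ((Primrec.nat_mul.to_comp).comp (Computable.snd.comp .snd) (hf.comp .fst)))
  refine this.of_eq fun n => ?_
  induction g n with
  | zero => rfl
  | succ m ih => rw [pow_succ, ← ih]

theorem Computable.polynomial_eval (P : Polynomial ℕ) : Computable fun n => P.eval n := by
  induction P using Polynomial.induction_on' with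
  | add p q hp hq => simpa only [Polynomial.eval_add] using hp.add_nat hq
  | monomial e c =>
    exact ((Computable.const c).mul_nat (Computable.id.pow_nat (.const e))).of_eq fun n => by
      rw [Polynomial.eval_monomial, id]

theorem Computable.sum_range {f : ℕ → ℕ} (hf : Computable f) :
    Computable fun n => ∑ i ∈ Finset.range n, f i := by
  have : Computable fun n : ℕ =>
      Nat.rec (motive := fun _ => ℕ) 0 (fun i r => r + f i) n :=
    Computable.nat_rec .id (.const 0)
      (Computable.to₂ ((Primrec.nat_add.to_comp).comp (Computable.snd.comp .snd)
        (hf.comp (Computable.fst.comp .snd))))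
  refine this.of_eq fun n => ?_
  induction n with
  | zero => rfl
  | succ m ih => rw [Finset.sum_range_succ, ← ih]

theorem Computable.choose_two_add_id : Computable fun h : ℕ => h.choose 2 + h := by
  refine Computable.add_nat ((Computable.sum_range .id).of_eq fun n => ?_) .id
  simp only [id_eq, Finset.sum_range_id, Nat.choose_two_right]

theorem le_sum_range_succ (f : ℕ → ℕ) {m n : ℕ} (h : m ≤ n) :
    f m ≤ ∑ i ∈ Finset.range (n + 1), f i :=
  Finset.single_le_sum (f := f) (fun _ _ => Nat.zero_le _) (Finset.mem_range.2 (by omega))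

theorem paramInput_eq_enc (x : SExp) (k : ℕ) : paramInput x k = enc (x, k) := rfl

theorem FPTReduces.trans {P Q R : ParamProblem} (h₁ : FPTReduces P Q) (h₂ : FPTReduces Q R) :
    FPTReduces P R := by
  obtain ⟨p₁, f₁, g₁, e₁, hf₁, hg₁, h₁⟩ := h₁
  obtain ⟨p₂, f₂, g₂, e₂, hf₂, hg₂, h₂⟩ := h₂
  -- `f₂` and `g₂` need not be monotone, so they are replaced by their sums up to `g₁ k`.
  have hsum : ∀ {f : ℕ → ℕ}, Computable f →
      Computable fun k => ∑ i ∈ Finset.range (g₁ k + 1), f i := fun hf =>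
    (Computable.sum_range hf).comp (hg₁.add_nat (.const 1))
  refine ⟨.seq p₁ p₂, fun k => f₁ k + (∑ i ∈ Finset.range (g₁ k + 1), f₂ i) * f₁ k ^ e₂ + 1,
    fun k => ∑ i ∈ Finset.range (g₁ k + 1), g₂ i, e₁ + e₁ * e₂,
    (hf₁.add_nat ((hsum hf₂).mul_nat (hf₁.pow_nat (.const e₂)))).add_nat (.const 1), hsum hg₂,
    fun x k => ?_⟩
  obtain ⟨x', k', t₁, hr₁, ht₁, hk', hiff₁⟩ := h₁ x k
  obtain ⟨x'', k'', t₂, hr₂, ht₂, hk'', hiff₂⟩ := h₂ x' k'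
  refine ⟨x'', k'', _, .seq hr₁ hr₂, ?_, hk''.trans (le_sum_range_succ g₂ hk'),
    hiff₁.trans hiff₂⟩
  have hx : 1 ≤ x.size := x.size_pos
  have hx' : x'.size ≤ f₁ k * x.size ^ e₁ := by
    have : (paramInput x' k').size ≤ t₁ := hr₁.size_output_le
    simp only [paramInput, SExp.size] at this
    omega
  have hf := le_sum_range_succ f₂ hk'
  set F := ∑ i ∈ Finset.range (g₁ k + 1), f₂ i
  have h3 : t₂ ≤ F * (f₁ k * x.size ^ e₁) ^ e₂ := ht₂.trans (by gcongr)
  have h4 : F * (f₁ k * x.size ^ e₁) ^ e₂ = F * f₁ k ^ e₂ * x.size ^ (e₁ * e₂) := by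
    rw [mul_pow, ← pow_mul]; ring
  have h5 : x.size ^ e₁ ≤ x.size ^ (e₁ + e₁ * e₂) := Nat.pow_le_pow_right hx (by omega)
  have h6 : x.size ^ (e₁ * e₂) ≤ x.size ^ (e₁ + e₁ * e₂) := Nat.pow_le_pow_right hx (by omega)
  have h7 : 1 ≤ x.size ^ (e₁ + e₁ * e₂) := Nat.one_le_pow _ _ hx
  calc t₁ + t₂ + 1
      ≤ f₁ k * x.size ^ e₁ + F * f₁ k ^ e₂ * x.size ^ (e₁ * e₂) + 1 := by omega
    _ ≤ f₁ k * x.size ^ (e₁ + e₁ * e₂) + F * f₁ k ^ e₂ * x.size ^ (e₁ + e₁ * e₂)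
        + x.size ^ (e₁ + e₁ * e₂) := by gcongr
    _ = _ := by ring

theorem PolyReducesWithParam.fptReduces {P Q : ParamProblem} {κ : ℕ → ℕ}
    (h : PolyReducesWithParam P Q κ) (hκ : Computable κ) : FPTReduces P Q := by
  obtain ⟨p, a, e, h⟩ := h
  refine ⟨p, fun k => a * (1 + k) ^ e, κ, e,
    (Computable.const a).mul_nat (((Computable.const 1).add_nat .id).pow_nat (.const e)), hκ,
    fun x k => ?_⟩
  obtain ⟨x', t, hr, ht, hiff⟩ := h x k
  refine ⟨x', κ k, t, hr, ht.trans ?_, le_rfl, hiff⟩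
  have hx := x.size_pos
  rw [mul_assoc, ← mul_pow]
  gcongr
  nlinarith

/-- A polynomial-time function is a polynomial-time reduction if it preserves yes-instances and
no-instances. -/
theorem PolyReducesWithParam.of_polyTime {P Q : ParamProblem} {κ : ℕ → ℕ}
    {R : SExp × ℕ → SExp × ℕ} (hR : PolyTime R) (hκ : ∀ x k, (R (x, k)).2 = κ k)
    (h : ∀ x k, (x, k) ∈ P ↔ R (x, k) ∈ Q) : PolyReducesWithParam P Q κ := by
  obtain ⟨T, ⟨B, hB⟩, p, hp⟩ := hR
  obtain ⟨c, e, hc⟩ := B.exists_eval_le_mul_pow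
  refine ⟨p, c * 4 ^ e, e, fun x k => ?_⟩
  obtain ⟨t, ht, hr⟩ := hp (x, k)
  have hx := x.size_pos
  have hxk : R (x, k) = ((R (x, k)).1, κ k) := by rw [← hκ x k]
  refine ⟨(R (x, k)).1, t, ?_, ?_, by rw [← hxk]; exact h x k⟩
  · rw [paramInput_eq_enc, paramInput_eq_enc, ← hxk]
    exact hr
  · refine ht.trans ((hB _).trans ((hc _ (sz_pos _)).trans ?_))
    rw [mul_assoc, ← mul_pow, sz_pair, sz_nat]
    change c * (x.size + (2 * k + 1) + 1) ^ e ≤ _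
    gcongr
    omega

/-- A reduction may first compute from the parameter `k` alone some data `pre k`, within a
computable time bound, and then work in polynomial time on the instance together with these data. -/
theorem FPTReduces.of_polyTime {β : Type} [Enc β] {P Q : ParamProblem} {pre : ℕ → β} {B g : ℕ → ℕ}
    {R : (SExp × ℕ) × β → SExp × ℕ} (hpre : RunsIn pre B) (hB : Computable B) (hR : PolyTime R)
    (hg : Computable g) (hRg : ∀ x k, (R ((x, k), pre k)).2 ≤ g k)
    (h : ∀ x k, (x, k) ∈ P ↔ R ((x, k), pre k) ∈ Q) : FPTReduces P Q := by
  obtain ⟨T, ⟨A, hA⟩, hr⟩ := hR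
  have hrun := hr.comp ((RunsIn.of_enc_eq (f := fun x : SExp × ℕ => x) fun _ => rfl).pair
    (hpre.comp RunsIn.snd))
  obtain ⟨p, hp⟩ := hrun
  obtain ⟨c, e, hc⟩ := (A + 3 * .X).exists_eval_le_mul_pow
  refine ⟨p, fun k => c * (2 * k + B k + 4) ^ e, g, e,
    (Computable.const c).mul_nat ((((((Computable.const 2).mul_nat .id).add_nat hB).add_nat
      (.const 4))).pow_nat (.const e)), hg, fun x k => ?_⟩
  obtain ⟨t, ht, hr⟩ := hp (x, k)
  refine ⟨_, _, t, hr, ?_, hRg x k, h x k⟩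
  have hx := x.size_pos
  have h1 : sz ((x, k), pre k) ≤ x.size + 2 * k + B k + 3 := by
    have := hpre.sz_le k
    rw [sz_pair, sz_pair, sz_nat]
    change x.size + _ + _ + _ + _ ≤ _
    omega
  have h2 : T ((x, k), pre k) ≤ A.eval (x.size + 2 * k + B k + 3) :=
    (hA _).trans (A.eval_le_eval_of_le h1)
  have h3 := hc (x.size + 2 * k + B k + 3) (by omega)
  rw [Polynomial.eval_add, Polynomial.eval_mul, Polynomial.eval_X] at h3
  have h4 : (Polynomial.eval (x.size + 2 * k + B k + 3) (3 : Polynomial ℕ)) = 3 := by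
    simp
  rw [h4] at h3
  have h5 : sz (x, k) = x.size + 2 * k + 2 := by
    rw [sz_pair, sz_nat]; change x.size + _ + _ = _; omega
  dsimp only at ht
  rw [h5] at ht
  rw [mul_assoc, ← mul_pow]
  have h6 : c * (x.size + 2 * k + B k + 3) ^ e ≤ c * ((2 * k + B k + 4) * x.size) ^ e := by
    gcongr
    nlinarith
  omega

/-! ### Precedence in duplicate-free lists -/

section
variable {α β : Type}

theorem Precedes.left_mem {l : List α} {a b : α} (h : Precedes l a b) : a ∈ l :=
  h.subset (by simp)

theorem Precedes.ne {l : List α} {a b : α} (h : Precedes l a b) (hl : l.Nodup) : a ≠ b := by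
  have := hl.sublist h
  simpa using this

theorem Precedes.not_head {l : List α} {a b : α} (h : Precedes (b :: l) a b) (hl : (b :: l).Nodup) :
    False := by
  unfold Precedes at h
  rw [List.sublist_cons_iff] at h
  rw [List.nodup_cons] at hl
  rcases h with h | ⟨r, hr, h⟩
  · exact hl.1 (h.subset (by simp))
  · simp only [List.cons.injEq] at hr
    rw [← hr.2] at h
    exact hl.1 (h.subset (by simp))

theorem precedes_map {f : α → β} (hf : f.Injective) (l : List α) (a b : α) :
    Precedes (l.map f) (f a) (f b) ↔ Precedes l a b := by
  refine ⟨fun h => ?_, fun h => h.map f⟩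
  obtain ⟨l', h, h'⟩ := List.sublist_map_iff.1 h
  have : [a, b] = l' := List.map_injective_iff.2 hf (by simpa using h')
  rwa [this.symm] at h

end

/-! ### Relabelling and encoding of matching instances -/

namespace MMInstance

variable {U W U' W' : Type}

theorem load_pos_iff [Fintype U] [DecidableEq W] {μ : U → Option W} {w : W} :
    0 < load μ w ↔ ∃ u, μ u = some w := by
  simp [load, Finset.card_pos, Finset.Nonempty]

theorem sum_load_of_isPerfect [Fintype U] [Fintype W] [DecidableEq W] {μ : U → Option W}
    (h : IsPerfect μ) : ∑ w, load μ w = Fintype.card U := by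
  choose g hg using fun u => Option.ne_none_iff_exists'.1 (h u)
  rw [← Finset.card_univ, Finset.card_eq_sum_card_fiberwise (f := g) (t := Finset.univ) (by simp)]
  simp [load, hg]

/-- The instance with students and schools renamed. -/
def relabel (I : MMInstance U W) (e : U ≃ U') (f : W ≃ W') : MMInstance U' W' where
  pref u := (I.pref (e.symm u)).map f
  prio w := (I.prio (f.symm w)).map e
  cap w := I.cap (f.symm w)
  pref_nodup u := (I.pref_nodup _).map f.injective
  prio_nodup w := (I.prio_nodup _).map e.injective
  pref_ne_nil u := by simpa using I.pref_ne_nil _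
  prio_ne_nil w := by simpa using I.prio_ne_nil _
  mem_pref_iff u w := by
    simp only [List.mem_map]
    constructor
    · rintro ⟨w', hw', rfl⟩
      exact ⟨e.symm u, by simpa using (I.mem_pref_iff _ _).1 hw', by simp⟩
    · rintro ⟨u', hu', rfl⟩
      exact ⟨f.symm w, by simpa using (I.mem_pref_iff _ _).2 hu', by simp⟩
  cap_pos w := I.cap_pos _

theorem relabel_relabel_symm (I : MMInstance U W) (e : U ≃ U') (f : W ≃ W') :
    (I.relabel e f).relabel e.symm f.symm = I := by
  cases I
  simp [relabel]

theorem HasSumSP.relabel [Fintype U] [Fintype W] [DecidableEq W] [Fintype U'] [Fintype W']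
    [DecidableEq W'] {I : MMInstance U W} {k : ℕ} (h : I.HasSumSP k) (e : U ≃ U') (f : W ≃ W') :
    (I.relabel e f).HasSumSP k := by
  obtain ⟨r, hr, μ, ⟨hm, hf, hb⟩, hp⟩ := h
  let μ' : U' → Option W' := fun u => (μ (e.symm u)).map f
  have hμ : ∀ u w, μ' u = some w ↔ μ (e.symm u) = some (f.symm w) := by
    intro u w
    simp only [μ', Option.map_eq_some_iff]
    constructor
    · rintro ⟨w', h, rfl⟩; simpa using h
    · intro h; exact ⟨_, h, by simp⟩
  have hload : ∀ w, load μ' w = load μ (f.symm w) := by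
    intro w
    refine Finset.card_bij' (fun u _ => e.symm u) (fun u _ => e u) ?_ ?_ (by simp) (by simp)
    · intro u hu; simpa [hμ] using hu
    · intro u hu; simpa [hμ] using hu
  refine ⟨fun w => r (f.symm w), ?_, μ', ⟨?_, ?_, ?_⟩, ?_⟩
  · rwa [f.symm.sum_comp r]
  · intro u w h
    exact List.mem_map.2 ⟨f.symm w, hm _ _ ((hμ u w).1 h), by simp⟩
  · intro w
    rw [hload]
    exact hf _
  · rintro u w ⟨h1, h2, h3⟩
    refine hb (e.symm u) (f.symm w) ⟨?_, ?_, ?_⟩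
    · obtain ⟨u', hu', rfl⟩ := List.mem_map.1 h1
      rw [Equiv.symm_apply_apply]
      exact hu'
    · rcases h2 with h2 | ⟨w', h2, h4⟩
      · left; simpa [μ'] using h2
      · refine .inr ⟨f.symm w', (hμ _ _).1 h2, ?_⟩
        rw [← precedes_map f.injective, f.apply_symm_apply, f.apply_symm_apply]
        exact h4
    · rcases h3 with h3 | ⟨u', h3, h4⟩
      · left; rw [hload] at h3; exact h3
      · refine .inr ⟨e.symm u', (hμ _ _).1 h3, ?_⟩
        rw [← precedes_map e.injective, e.apply_symm_apply, e.apply_symm_apply]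
        exact h4
  · intro u h
    exact hp (e.symm u) (by simpa [μ'] using h)

theorem hasSumSP_relabel_iff [Fintype U] [Fintype W] [DecidableEq W] [Fintype U'] [Fintype W']
    [DecidableEq W'] {I : MMInstance U W} {k : ℕ} (e : U ≃ U') (f : W ≃ W') :
    (I.relabel e f).HasSumSP k ↔ I.HasSumSP k :=
  ⟨fun h => by simpa only [relabel_relabel_symm] using h.relabel e.symm f.symm,
    fun h => h.relabel e f⟩

end MMInstance

theorem SExp.ofList_injective : Function.Injective SExp.ofList := by
  intro l
  induction l with
  | nil => intro l' h; cases l' <;> simp_all [ofList]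
  | cons a l ih =>
    intro l' h
    cases l' with
    | nil => simp [ofList] at h
    | cons b l' => simp only [ofList, cons.injEq] at h; rw [h.1, ih h.2]

theorem SExp.ofNat_injective : Function.Injective SExp.ofNat := by
  intro m n h
  have := congrArg toNat h
  rwa [show (ofNat m).toNat = m from toNat_enc m, show (ofNat n).toNat = n from toNat_enc n] at this

theorem SExp.ofNats_injective : Function.Injective SExp.ofNats := fun _ _ h =>
  List.map_injective_iff.2 ofNat_injective (ofList_injective h)

theorem MMInstance.HasSumSP.of_encode_eq {n m n' m' k : ℕ} {I : MMInstance (Fin n) (Fin m)}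
    {I' : MMInstance (Fin n') (Fin m')} (hI : I.HasSumSP k) (h : I.encode = I'.encode) :
    I'.HasSumSP k := by
  simp only [encode, SExp.cons.injEq] at h
  obtain ⟨h1, h2, h3⟩ := h
  replace h1 := SExp.ofList_injective h1
  replace h2 := SExp.ofList_injective h2
  replace h3 := SExp.ofNats_injective h3
  obtain rfl : n = n' := by simpa using congrArg List.length h1
  obtain rfl : m = m' := by simpa using congrArg List.length h2
  have hval : ∀ {j : ℕ}, Function.Injective (List.map (Fin.val : Fin j → ℕ)) := fun {j} =>
    List.map_injective_iff.2 Fin.val_injective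
  have e1 : I.pref = I'.pref :=
    funext fun u => hval (SExp.ofNats_injective (congrFun (List.ofFn_injective h1) u))
  have e2 : I.prio = I'.prio :=
    funext fun w => hval (SExp.ofNats_injective (congrFun (List.ofFn_injective h2) w))
  have e3 : I.cap = I'.cap := List.ofFn_injective h3
  have : I = I' := by
    cases I; cases I'; simp_all
  exact this ▸ hI

/-- A numbering of a type along a list of all its elements. -/
theorem exists_equiv_of_map_eq_range {U : Type} {us : List U} {num : U → ℕ} {n : ℕ}
    (hnum : us.map num = List.range n) (hmem : ∀ u, u ∈ us) :
    ∃ e : U ≃ Fin n, (∀ u, (e u : ℕ) = num u) ∧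
      ∀ {β : Type} (g : U → β), List.ofFn (fun i => g (e.symm i)) = us.map g := by
  have hlt : ∀ u, num u < n := fun u => by
    rw [← List.mem_range, ← hnum]
    exact List.mem_map_of_mem (hmem u)
  have hinj : Function.Injective num := fun u v h =>
    List.inj_on_of_nodup_map (hnum ▸ List.nodup_range) (hmem u) (hmem v) h
  have hsurj : Function.Surjective fun u => (⟨num u, hlt u⟩ : Fin n) := fun i => by
    have : (i : ℕ) ∈ us.map num := by rw [hnum]; simp
    obtain ⟨u, -, hu⟩ := List.mem_map.1 this
    exact ⟨u, Fin.ext hu⟩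
  let e : U ≃ Fin n := Equiv.ofBijective _ ⟨fun u v h => hinj (congrArg Fin.val h), hsurj⟩
  have he : ∀ u, (e u : ℕ) = num u := fun u => rfl
  refine ⟨e, he, fun g => ?_⟩
  have : List.ofFn e.symm = us := by
    refine List.map_injective_iff.2 hinj ?_
    rw [hnum, List.map_ofFn]
    have : num ∘ e.symm = fun i : Fin n => (i : ℕ) := funext fun i => by
      rw [Function.comp, ← he, e.apply_symm_apply]
    rw [this, List.ofFn_eq_map, List.map_coe_finRange_eq_range]
  rw [← this, List.map_ofFn]
  rfl

/-! ### The matching instance of a colored graph -/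

/-- An unordered pair of distinct colors, given by its larger element and its smaller one. -/
abbrev ColorPair (h : ℕ) : Type := Σ j : Fin h, Fin j

/-- The smaller color of a pair. -/
def ColorPair.low {h : ℕ} (p : ColorPair h) : Fin h := ⟨p.2, p.2.2.trans p.1.2⟩

/-- The pair of two colors, or nothing if they are equal. -/
def ColorPair.ofColors {h : ℕ} (c d : Fin h) : List (ColorPair h) :=
  if hlt : c < d then [⟨d, ⟨c, hlt⟩⟩] else if hlt : d < c then [⟨c, ⟨d, hlt⟩⟩] else []

theorem ColorPair.mem_ofColors {h : ℕ} {c d : Fin h} {p : ColorPair h} :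
    p ∈ ofColors c d ↔ (c = p.low ∧ d = p.1) ∨ (c = p.1 ∧ d = p.low) := by
  obtain ⟨j, i, hij⟩ := p
  simp only [ofColors, low]
  split_ifs with h1 h2
  · simp only [List.mem_singleton]
    constructor
    · intro hp
      obtain ⟨rfl, hp⟩ := Sigma.mk.inj_iff.1 hp
      have := eq_of_heq hp
      simp only [Fin.mk.injEq] at this
      left; exact ⟨Fin.ext this.symm, rfl⟩
    · rintro (⟨rfl, rfl⟩ | ⟨rfl, rfl⟩)
      · rfl
      · exact absurd (Fin.lt_def.1 h1) (by simp; omega)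
  · simp only [List.mem_singleton]
    constructor
    · intro hp
      obtain ⟨rfl, hp⟩ := Sigma.mk.inj_iff.1 hp
      have := eq_of_heq hp
      simp only [Fin.mk.injEq] at this
      right; exact ⟨rfl, Fin.ext this.symm⟩
    · rintro (⟨rfl, rfl⟩ | ⟨rfl, rfl⟩)
      · exact absurd (Fin.lt_def.1 h2) (by simp; omega)
      · rfl
  · simp only [List.not_mem_nil, false_iff]
    rintro (⟨rfl, rfl⟩ | ⟨rfl, rfl⟩)
    · exact h1 (Fin.lt_def.2 hij)
    · exact h2 (Fin.lt_def.2 hij)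

namespace MCCInstance

variable {h : ℕ} (I : MCCInstance h)

/-- The edge at a position of the edge list. -/
def edge (e : Fin I.edges.length) : Fin I.n × Fin I.n := I.edges.get e

/-- Choosing a multi-colored clique amounts to choosing a vertex of every color. -/
theorem hasMultiColoredClique_iff : I.HasMultiColoredClique ↔
    ∃ s : Fin h → Fin I.n, (∀ i, I.color (s i) = i) ∧ ∀ i j, i ≠ j → I.graph.Adj (s i) (s j) := by
  constructor
  · rintro ⟨S, hS, hex⟩
    choose s hs _ using hex
    refine ⟨s, fun i => (hs i).2, fun i j hij => hS.isClique (hs i).1 (hs j).1 fun h => hij ?_⟩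
    rw [← (hs i).2, h, (hs j).2]
  · rintro ⟨s, hs, hadj⟩
    have hinj : Function.Injective s := fun i j hij => by rw [← hs i, hij, hs j]
    refine ⟨Finset.univ.image s, (SimpleGraph.isNClique_iff _).2 ⟨?_, ?_⟩, fun i => ⟨s i, ?_, ?_⟩⟩
    · intro x hx y hy hxy
      simp only [Finset.coe_image, Finset.coe_univ, Set.image_univ, Set.mem_range] at hx hy
      obtain ⟨i, rfl⟩ := hx
      obtain ⟨j, rfl⟩ := hy
      exact hadj i j fun hij => hxy (by rw [hij])
    · rw [Finset.card_image_of_injective _ hinj]; simp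
    · exact ⟨by simp, hs i⟩
    · rintro v ⟨hv, rfl⟩
      simp only [Finset.mem_image, Finset.mem_univ, true_and] at hv
      obtain ⟨j, rfl⟩ := hv
      rw [hs]

theorem edge_ne (e : Fin I.edges.length) : (I.edge e).1 ≠ (I.edge e).2 :=
  I.edges_ne _ (I.edges.get_mem e)

/-- The students of the constructed instance. -/
inductive Student
  /-- the student of a vertex -/
  | vertex (v : Fin I.n)
  /-- a student who occupies a seat at the shelter of a vertex -/
  | shelterSeat (v : Fin I.n)
  /-- a student who occupies a seat at the school of an edge -/
  | edgeSeat (e : Fin I.edges.length)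
  /-- the student of a color, who looks for a home of that color -/
  | color (i : Fin h)
  /-- the student of a pair of colors, who looks for an edge between these colors -/
  | pair (p : ColorPair h)

/-- The schools of the constructed instance. Each of them has capacity one. -/
inductive School
  /-- where the student of a vertex goes if the vertex is selected -/
  | shelter (v : Fin I.n)
  /-- where the student of a vertex goes if the vertex is not selected -/
  | home (v : Fin I.n)
  /-- the school of an edge -/
  | edge (e : Fin I.edges.length)

/-- The pair of colors of the endpoints of an edge, or nothing if they have the same color. -/
def colorPairs (e : Fin I.edges.length) : List (ColorPair h) :=
  ColorPair.ofColors (I.color (I.edge e).1) (I.color (I.edge e).2)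

theorem mem_colorPairs {e : Fin I.edges.length} {p : ColorPair h} :
    p ∈ I.colorPairs e ↔ (I.color (I.edge e).1 = p.low ∧ I.color (I.edge e).2 = p.1) ∨
      (I.color (I.edge e).1 = p.1 ∧ I.color (I.edge e).2 = p.low) := ColorPair.mem_ofColors

theorem eq_of_mem_colorPairs {e : Fin I.edges.length} {p p' : ColorPair h}
    (hp : p ∈ I.colorPairs e) (hp' : p' ∈ I.colorPairs e) : p = p' := by
  unfold colorPairs ColorPair.ofColors at hp hp'
  split_ifs at hp hp' <;> simp_all

theorem exists_edge_of_clique {s : Fin h → Fin I.n} (hs : ∀ i, I.color (s i) = i)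
    (hadj : ∀ i j, i ≠ j → I.graph.Adj (s i) (s j)) (p : ColorPair h) :
    ∃ e, p ∈ I.colorPairs e ∧
      ∀ v, ((I.edge e).1 = v ∨ (I.edge e).2 = v) → v = s (I.color v) := by
  have := hadj p.low p.1 fun h => absurd (congrArg Fin.val h) (ne_of_lt p.2.2)
  simp only [graph, SimpleGraph.fromRel_adj] at this
  rcases this.2 with he | he <;> obtain ⟨e, he⟩ := List.mem_iff_get.1 he
  · have h1 : I.edge e = (s p.low, s p.1) := he
    refine ⟨e, I.mem_colorPairs.2 (.inl ?_), ?_⟩ <;> rw [h1]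
    · exact ⟨hs _, hs _⟩
    · rintro v (rfl | rfl) <;> simp only [hs]
  · have h1 : I.edge e = (s p.1, s p.low) := he
    refine ⟨e, I.mem_colorPairs.2 (.inr ?_), ?_⟩ <;> rw [h1]
    · exact ⟨hs _, hs _⟩
    · rintro v (rfl | rfl) <;> simp only [hs]

/-- The preference lists of the constructed instance. -/
def studentPref : I.Student → List I.School
  | .vertex v => .shelter v ::
      (((List.finRange _).filter fun e => (I.edge e).1 = v ∨ (I.edge e).2 = v).map School.edge ++
        [.home v])
  | .shelterSeat v => [.shelter v]
  | .edgeSeat e => [.edge e]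
  | .color i => ((List.finRange _).filter fun v => I.color v = i).map .home
  | .pair p => ((List.finRange _).filter fun e => p ∈ I.colorPairs e).map .edge

/-- The priority orders of the constructed instance. -/
def schoolPrio : I.School → List I.Student
  | .shelter v => [.shelterSeat v, .vertex v]
  | .home v => [.vertex v, .color (I.color v)]
  | .edge e => .edgeSeat e :: .vertex (I.edge e).1 :: .vertex (I.edge e).2 ::
      (I.colorPairs e).map .pair

/-- The instance of Many-To-One Matching constructed from a colored graph in which every color and
every pair of colors occurs. -/
def matching (hpref : ∀ u, I.studentPref u ≠ []) : MMInstance I.Student I.School where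
  pref := I.studentPref
  prio := I.schoolPrio
  cap _ := 1
  pref_nodup u := by
    cases u with
    | vertex v =>
      simp only [studentPref, List.nodup_cons, List.mem_append, List.mem_map, List.nodup_append]
      refine ⟨by simp, ((List.nodup_finRange _).filter _).map (fun _ _ => by simp), by simp, ?_⟩
      simp
    | shelterSeat v => simp [studentPref]
    | edgeSeat e => simp [studentPref]
    | color i => exact ((List.nodup_finRange _).filter _).map (fun _ _ => by simp)
    | pair p => exact ((List.nodup_finRange _).filter _).map (fun _ _ => by simp)
  prio_nodup w := by
    cases w with
    | shelter v => simp [schoolPrio]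
    | home v => simp [schoolPrio]
    | edge e =>
      have h1 := I.edge_ne e
      have h2 : (I.colorPairs e).Nodup := by
          unfold colorPairs ColorPair.ofColors; split_ifs <;> simp
      simp only [schoolPrio, List.nodup_cons, List.mem_cons, List.mem_map]
      refine ⟨by simp, by simpa using h1, by simp, h2.map (fun _ _ => by simp)⟩
  pref_ne_nil := hpref
  prio_ne_nil w := by cases w <;> simp [schoolPrio]
  mem_pref_iff u w := by
    cases u <;> cases w <;> simp [studentPref, schoolPrio] <;> grind
  cap_pos _ := one_pos

section
variable [Fintype I.Student] [Fintype I.School] [DecidableEq I.School]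

/-- The number of students exceeds the number of seats by the allowed capacity increase, so in a
perfect matching every seat is taken. In particular the home of a vertex whose student is not there
is taken by the student of its color. The students of pairs of colors sit at schools of edges, and
stability makes sure that the students of both endpoints are not at home. -/
theorem hasMultiColoredClique_of_hasSumSP (hpref : ∀ u, I.studentPref u ≠ []) {K : ℕ}
    (hK : Fintype.card I.Student = Fintype.card I.School + K)
    (hS : (I.matching hpref).HasSumSP K) : I.HasMultiColoredClique := by
  obtain ⟨r, hr, μ, ⟨hm, hf, hb⟩, hp⟩ := hS
  have hload : ∀ w, 0 < MMInstance.load μ w := by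
    have h1 : ∑ w, MMInstance.load μ w = ∑ w, (1 + r w) := by
      refine le_antisymm (Finset.sum_le_sum fun w _ => hf w) ?_
      rw [MMInstance.sum_load_of_isPerfect hp, hK, Finset.sum_add_distrib]
      simpa using hr
    intro w
    have := (Finset.sum_eq_sum_iff_of_le fun w _ => hf w).1 h1 w (Finset.mem_univ _)
    rw [this]
    exact (I.matching hpref |>.increase r).cap_pos w
  -- the home that the student of a color occupies
  have hcolor : ∀ i, ∃ v, I.color v = i ∧ μ (.color i) = some (.home v) := by
    intro i
    obtain ⟨w, hw⟩ := Option.ne_none_iff_exists'.1 (hp (.color i))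
    have : w ∈ I.studentPref (.color i) := hm _ _ hw
    simp only [studentPref, List.mem_map, List.mem_filter, List.mem_finRange, true_and,
      decide_eq_true_eq] at this
    obtain ⟨v, hv, rfl⟩ := this
    exact ⟨v, hv, hw⟩
  choose s hs hμs using hcolor
  have hedge : ∀ p : ColorPair h, ∃ e, p ∈ I.colorPairs e ∧ μ (.pair p) = some (.edge e) := by
    intro p
    obtain ⟨w, hw⟩ := Option.ne_none_iff_exists'.1 (hp (.pair p))
    have : w ∈ I.studentPref (.pair p) := hm _ _ hw
    simp only [studentPref, List.mem_map, List.mem_filter, List.mem_finRange, true_and,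
      decide_eq_true_eq] at this
    obtain ⟨v, hv, rfl⟩ := this
    exact ⟨v, hv, hw⟩
  have hhome : ∀ p e v, p ∈ I.colorPairs e → μ (.pair p) = some (.edge e) →
      ((I.edge e).1 = v ∨ (I.edge e).2 = v) → s (I.color v) = v := by
    intro p e v hpe hμ hv
    have h1 : μ (.vertex v) ≠ some (.home v) := by
      intro hvh
      refine hb (.vertex v) (.edge e) ⟨?_, .inr ⟨_, hvh, ?_⟩, .inr ⟨_, hμ, ?_⟩⟩
      · change Student.vertex v ∈ I.schoolPrio (.edge e)
        rcases hv with rfl | rfl <;> simp [schoolPrio]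
      · change List.Sublist _ (I.studentPref (.vertex v))
        refine List.Sublist.cons _ ?_
        have : [School.edge e] ⊆ (((List.finRange _).filter fun e =>
            (I.edge e).1 = v ∨ (I.edge e).2 = v).map (School.edge (I := I))) := by
          simpa using hv
        exact List.Sublist.append (List.singleton_sublist.2 (this (by simp)))
          (List.Sublist.refl [School.home v])
      · change List.Sublist _ (I.schoolPrio (.edge e))
        have h2 : [Student.pair p].Sublist ((I.colorPairs e).map (Student.pair (I := I))) :=
          List.singleton_sublist.2 (List.mem_map_of_mem hpe)
        refine List.Sublist.cons _ ?_
        rcases hv with rfl | rfl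
        · exact (h2.cons _).cons_cons _
        · exact (h2.cons_cons _).cons _
    obtain ⟨u, hu⟩ := MMInstance.load_pos_iff.1 (hload (.home v))
    have h2 : u ∈ I.schoolPrio (.home v) := ((I.matching hpref).mem_pref_iff _ _).1 (hm _ _ hu)
    simp only [schoolPrio, List.mem_cons, List.not_mem_nil, or_false] at h2
    rcases h2 with rfl | rfl
    · exact absurd hu h1
    · have := (hμs (I.color v)).symm.trans hu
      simpa using this
  have hadj : ∀ p : ColorPair h, I.graph.Adj (s p.low) (s p.1) := by
    intro p
    obtain ⟨e, hpe, hμ⟩ := hedge p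
    have h1 := hhome p e _ hpe hμ (.inl rfl)
    have h2 := hhome p e _ hpe hμ (.inr rfl)
    have h3 : ((I.edge e).1, (I.edge e).2) ∈ I.edges := I.edges.get_mem e
    have h4 := I.edge_ne e
    rcases I.mem_colorPairs.1 hpe with ⟨h5, h6⟩ | ⟨h5, h6⟩ <;> rw [h5] at h1 <;> rw [h6] at h2 <;>
      rw [h1, h2] <;> simp only [graph, SimpleGraph.fromRel_adj]
    · exact ⟨h4, .inl h3⟩
    · exact ⟨h4.symm, .inr h3⟩
  refine I.hasMultiColoredClique_iff.2 ⟨s, hs, fun i j hij => ?_⟩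
  rcases lt_or_gt_of_ne hij with hlt | hlt
  · exact hadj ⟨j, ⟨i, hlt⟩⟩
  · exact (hadj ⟨i, ⟨j, hlt⟩⟩).symm

/-- Given a clique, a seat is added at the shelters of its vertices and at the schools of its
edges. -/
theorem hasSumSP_of_hasMultiColoredClique (hpref : ∀ u, I.studentPref u ≠ []) {K : ℕ}
    (hK : Fintype.card I.Student = Fintype.card I.School + K)
    (hC : I.HasMultiColoredClique) : (I.matching hpref).HasSumSP K := by
  classical
  obtain ⟨s, hs, hadj⟩ := I.hasMultiColoredClique_iff.1 hC
  have hedge := I.exists_edge_of_clique hs hadj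
  choose ε hε hεs using hedge
  let μ : I.Student → Option I.School
    | .vertex v => if v = s (I.color v) then some (.shelter v) else some (.home v)
    | .shelterSeat v => some (.shelter v)
    | .edgeSeat e => some (.edge e)
    | .color i => some (.home (s i))
    | .pair p => some (.edge (ε p))
  have hperf : MMInstance.IsPerfect μ := by
    rintro (v | v | e | i | p) <;> simp only [μ]
    · split_ifs <;> simp
    all_goals simp
  have hload : ∀ w, 0 < MMInstance.load μ w := by
    intro w
    rw [MMInstance.load_pos_iff]
    cases w with
    | shelter v => exact ⟨.shelterSeat v, rfl⟩
    | edge e => exact ⟨.edgeSeat e, rfl⟩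
    | home v =>
      by_cases hv : v = s (I.color v)
      · exact ⟨.color (I.color v), by simp only [μ]; rw [← hv]⟩
      · exact ⟨.vertex v, by simp only [μ, if_neg hv]⟩
  -- The capacities are chosen such that no seat is free.
  refine ⟨fun w => MMInstance.load μ w - 1, ?_, μ, ⟨?_, ?_, ?_⟩, hperf⟩
  · have h1 : ∑ w, (MMInstance.load μ w - 1 + 1) = ∑ w, MMInstance.load μ w :=
      Finset.sum_congr rfl fun w _ => Nat.sub_add_cancel (hload w)
    rw [MMInstance.sum_load_of_isPerfect hperf, hK, Finset.sum_add_distrib] at h1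
    simp only [Finset.sum_const, Finset.card_univ, smul_eq_mul, mul_one] at h1
    change ∑ w, (MMInstance.load μ w - 1) ≤ K
    omega
  · intro u w hw
    change w ∈ I.studentPref u
    cases u with
    | vertex v =>
      simp only [μ] at hw
      split_ifs at hw <;> obtain rfl := Option.some.inj hw <;> simp [studentPref]
    | shelterSeat v => obtain rfl := Option.some.inj hw; simp [studentPref]
    | edgeSeat e => obtain rfl := Option.some.inj hw; simp [studentPref]
    | color i => obtain rfl := Option.some.inj hw; simp [studentPref, hs]
    | pair p => obtain rfl := Option.some.inj hw; simp [studentPref, hε]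
  · intro w
    change _ ≤ 1 + (_ - 1)
    omega
  · rintro u w ⟨h1, h2, h3⟩
    replace h1 : w ∈ I.studentPref u := ((I.matching hpref).mem_pref_iff _ _).2 h1
    obtain ⟨w', hw', h2⟩ := h2.resolve_left (hperf u)
    obtain ⟨u', hu', h3⟩ := h3.resolve_left (by
      change ¬ _ < 1 + (_ - 1)
      have := hload w
      omega)
    replace h2 : Precedes (I.studentPref u) w w' := h2
    replace h3 : Precedes (I.schoolPrio w) u u' := h3
    have hnw : w ≠ w' := h2.ne ((I.matching hpref).pref_nodup u)
    have hnu : u ≠ u' := h3.ne ((I.matching hpref).prio_nodup w)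
    have hnd := (I.matching hpref).prio_nodup w
    -- the first student in the order of a school never envies
    have hhead : ∀ l, I.schoolPrio w = u' :: l → False := fun l hl => by
      change (I.schoolPrio w).Nodup at hnd
      rw [hl] at h3 hnd
      exact h3.not_head hnd
    cases w with
    | shelter v =>
      cases u' with
      | shelterSeat v' =>
        obtain rfl : v' = v := by simpa [μ] using hu'
        exact hhead _ rfl
      | vertex v' =>
        have : v' = v := by
          simp only [μ] at hu'
          split_ifs at hu'
          · simpa using hu'
          · simp at hu'
        subst this
        have h4 := h3.left_mem
        simp only [schoolPrio, List.mem_cons, List.not_mem_nil, or_false] at h4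
        rcases h4 with rfl | rfl
        · exact hnw (by simpa [μ] using hw')
        · exact hnu rfl
      | edgeSeat e => simp [μ] at hu'
      | color i => simp [μ] at hu'
      | pair p => simp [μ] at hu'
    | home v =>
      cases u' with
      | vertex v' =>
        have : v' = v := by
          simp only [μ] at hu'
          split_ifs at hu'
          · simp at hu'
          · simpa using hu'
        subst this
        exact hhead _ rfl
      | color i =>
        obtain rfl : s i = v := by simpa [μ] using hu'
        have h4 := h3.left_mem
        simp only [schoolPrio, List.mem_cons, List.not_mem_nil, or_false] at h4
        rcases h4 with rfl | rfl
        · -- home is the last choice of the student of a vertex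
          have h5 : I.color (s i) = i := hs i
          have h6 : some (School.shelter (s i)) = some w' := by simpa [μ, h5] using hw'
          obtain rfl := Option.some.inj h6
          have h7 := (I.matching hpref).pref_nodup (.vertex (s i))
          exact h2.not_head h7
        · exact hnu (by rw [hs i])
      | shelterSeat v' => simp [μ] at hu'
      | edgeSeat e => simp [μ] at hu'
      | pair p => simp [μ] at hu'
    | edge e =>
      cases u' with
      | edgeSeat e' =>
        obtain rfl : e' = e := by simpa [μ] using hu'
        exact hhead _ rfl
      | pair p =>
        obtain rfl : ε p = e := by simpa [μ] using hu'
        cases u with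
        | vertex v =>
          have h5 : (I.edge (ε p)).1 = v ∨ (I.edge (ε p)).2 = v := by
            simpa [studentPref] using h1
          have h6 := hεs p v h5
          have h7 : some (School.shelter v) = some w' := by
            rw [← hw']; simp only [μ]; rw [if_pos h6]
          obtain rfl := Option.some.inj h7
          exact h2.not_head ((I.matching hpref).pref_nodup (.vertex v))
        | shelterSeat v => simp [studentPref] at h1
        | edgeSeat e =>
          exact hnw (by rw [← Option.some.injEq, ← hw']; simpa [studentPref, μ] using h1)
        | color i => simp [studentPref] at h1
        | pair p' =>
          have : p' ∈ I.colorPairs (ε p) := by simpa [studentPref] using h1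
          exact hnu (by rw [I.eq_of_mem_colorPairs this (hε p)])
      | vertex v' =>
        simp only [μ] at hu'
        split_ifs at hu' <;> simp at hu'
      | shelterSeat v' => simp [μ] at hu'
      | color i => simp [μ] at hu'

end

end MCCInstance

/-! ### Computing the matching instance -/

section
variable {α : Type} [Enc α]

theorem map_finRange {β : Type} (n : ℕ) (f : ℕ → β) :
    ((List.finRange n).map fun i : Fin n => f i) = (List.range n).map f := by
  rw [← List.map_coe_finRange_eq_range, List.map_map]
  rfl

theorem flatMap_finRange {β : Type} (n : ℕ) (f : ℕ → List β) :
    ((List.finRange n).flatMap fun i : Fin n => f i) = (List.range n).flatMap f := by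
  rw [List.flatMap_def, map_finRange, ← List.flatMap_def]

theorem map_filter_finRange {β : Type} (n : ℕ) (p : ℕ → Bool) (f : ℕ → β) :
    (((List.finRange n).filter fun i : Fin n => p i).map fun i : Fin n => f i) =
      ((List.range n).filter p).map f := by
  rw [← List.map_coe_finRange_eq_range, List.filter_map, List.map_map]
  rfl

/-- The number of pairs of numbers below `n`. -/
def numPairs (n : ℕ) : ℕ := ((List.range n).flatMap fun j => List.range j).length

theorem numPairs_succ (n : ℕ) : numPairs (n + 1) = numPairs n + n := by
  simp [numPairs, List.range_succ]

theorem numPairs_eq_choose (n : ℕ) : numPairs n = n.choose 2 := by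
  induction n with
  | zero => rfl
  | succ n ih => rw [numPairs_succ, ih, Nat.choose_succ_succ' n 1, Nat.choose_one_right, add_comm]

/-- Numbering the pairs `i < j` by `numPairs j + i` leaves no gaps. -/
theorem flatMap_numPairs_add (n : ℕ) :
    ((List.range n).flatMap fun j => (List.range j).map fun i => numPairs j + i) =
      List.range (numPairs n) := by
  induction n with
  | zero => rfl
  | succ n ih =>
    rw [List.range_succ, List.flatMap_append, ih, numPairs_succ, List.range_add]
    simp

@[fun_prop]
theorem PolyTime.numPairs {f : α → ℕ} (hf : PolyTime f) : PolyTime fun a => numPairs (f a) := by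
  unfold _root_.numPairs; fun_prop

end

namespace MCCProgram

/-! In the functions below, a colored graph with `h` colors is given by the list `cs` of the colors
of its vertices and by the list `es` of its edges. -/

section
variable (cs : List ℕ) (es : List (ℕ × ℕ)) (h : ℕ)

/-- The color of the first endpoint of the edge at position `e`. -/
def color₁ (e : ℕ) : ℕ := cs.getD (es.getD e (0, 0)).1 0

/-- The color of the second endpoint of the edge at position `e`. -/
def color₂ (e : ℕ) : ℕ := cs.getD (es.getD e (0, 0)).2 0

/-- The number of the first student who belongs to a color. -/
def colorOffset : ℕ := cs.length + cs.length + es.length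

/-- The number of the student who belongs to the pair of the colors `c` and `d`. -/
def pairNumber (c d : ℕ) : List ℕ :=
  bif decide (c < d) then [colorOffset cs es + h + (numPairs d + c)] else
    bif decide (d < c) then [colorOffset cs es + h + (numPairs c + d)] else []

/-- The preference lists. -/
def prefs : List (List ℕ) :=
  ((List.range cs.length).map fun v => v ::
      ((((List.range es.length).filter fun e =>
        decide ((es.getD e (0, 0)).1 = v) || decide ((es.getD e (0, 0)).2 = v)).map fun e =>
          cs.length + cs.length + e) ++ [cs.length + v])) ++
    ((List.range cs.length).map fun v => [v]) ++
    ((List.range es.length).map fun e => [cs.length + cs.length + e]) ++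
    ((List.range h).map fun i =>
      ((List.range cs.length).filter fun v => decide (cs.getD v 0 = i)).map fun v =>
        cs.length + v) ++
    (List.range h).flatMap fun j => (List.range j).map fun i =>
      ((List.range es.length).filter fun e =>
        (decide (color₁ cs es e = i) && decide (color₂ cs es e = j)) ||
          (decide (color₁ cs es e = j) && decide (color₂ cs es e = i))).map fun e =>
        cs.length + cs.length + e

/-- The priority orders. -/
def prios : List (List ℕ) :=
  ((List.range cs.length).map fun v => [cs.length + v, v]) ++
    ((List.range cs.length).map fun v => [v, colorOffset cs es + cs.getD v 0]) ++
    (List.range es.length).map fun e => (cs.length + cs.length + e) :: (es.getD e (0, 0)).1 ::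
      (es.getD e (0, 0)).2 :: pairNumber cs es h (color₁ cs es e) (color₂ cs es e)

/-- The capacities. -/
def caps : List ℕ := (List.range (colorOffset cs es)).map fun _ => 1

end

section
variable {α : Type} [Enc α] {cs : α → List ℕ} {es : α → List (ℕ × ℕ)} {h : α → ℕ}

@[fun_prop]
theorem polyTime_color₁ {e : α → ℕ} (hcs : PolyTime cs) (hes : PolyTime es) (he : PolyTime e) :
    PolyTime fun a => color₁ (cs a) (es a) (e a) := by
  unfold color₁; fun_prop

@[fun_prop]
theorem polyTime_color₂ {e : α → ℕ} (hcs : PolyTime cs) (hes : PolyTime es) (he : PolyTime e) :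
    PolyTime fun a => color₂ (cs a) (es a) (e a) := by
  unfold color₂; fun_prop

@[fun_prop]
theorem polyTime_colorOffset (hcs : PolyTime cs) (hes : PolyTime es) :
    PolyTime fun a => colorOffset (cs a) (es a) := by
  unfold colorOffset; fun_prop

@[fun_prop]
theorem polyTime_pairNumber {c d : α → ℕ} (hcs : PolyTime cs) (hes : PolyTime es)
    (hh : PolyTime h) (hc : PolyTime c) (hd : PolyTime d) :
    PolyTime fun a => pairNumber (cs a) (es a) (h a) (c a) (d a) := by
  unfold pairNumber; fun_prop

@[fun_prop]
theorem polyTime_prefs (hcs : PolyTime cs) (hes : PolyTime es) (hh : PolyTime h) :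
    PolyTime fun a => prefs (cs a) (es a) (h a) := by
  unfold prefs; fun_prop

@[fun_prop]
theorem polyTime_prios (hcs : PolyTime cs) (hes : PolyTime es) (hh : PolyTime h) :
    PolyTime fun a => prios (cs a) (es a) (h a) := by
  unfold prios; fun_prop

@[fun_prop]
theorem polyTime_caps (hcs : PolyTime cs) (hes : PolyTime es) :
    PolyTime fun a => caps (cs a) (es a) := by
  unfold caps; fun_prop

end

end MCCProgram

namespace MCCInstance

variable {h : ℕ} (I : MCCInstance h)

/-- The colors of the vertices. -/
def colorList : List ℕ := List.ofFn fun v => (I.color v : ℕ)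

/-- The edges, as pairs of numbers. -/
def edgeList : List (ℕ × ℕ) := I.edges.map fun e => ((e.1 : ℕ), (e.2 : ℕ))

theorem encode_eq_enc : I.encode = enc (I.colorList, I.edgeList) := by
  simp only [encode, edgeList, enc, SExp.ofNats, List.map_map, colorList]
  rfl

@[simp] theorem length_colorList : I.colorList.length = I.n := by simp [colorList]

@[simp] theorem length_edgeList : I.edgeList.length = I.edges.length := by simp [edgeList]

@[simp] theorem getD_colorList (v : Fin I.n) : I.colorList.getD v 0 = I.color v := by
  simp [colorList]

@[simp] theorem getD_edgeList (e : Fin I.edges.length) :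
    I.edgeList.getD e (0, 0) = (((I.edge e).1 : ℕ), ((I.edge e).2 : ℕ)) := by
  simp [edgeList, edge]

theorem color₁_eq (e : Fin I.edges.length) :
    MCCProgram.color₁ I.colorList I.edgeList e = I.color (I.edge e).1 := by
  simp only [MCCProgram.color₁, getD_edgeList, getD_colorList]

theorem color₂_eq (e : Fin I.edges.length) :
    MCCProgram.color₂ I.colorList I.edgeList e = I.color (I.edge e).2 := by
  simp only [MCCProgram.color₂, getD_edgeList, getD_colorList]

/-- The students in the order of their numbers. -/
def students : List I.Student :=
  (List.finRange _).map .vertex ++ (List.finRange _).map .shelterSeat ++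
    (List.finRange _).map .edgeSeat ++ (List.finRange _).map .color ++
    (List.finRange h).flatMap fun j : Fin h => (List.finRange j).map fun i : Fin j => .pair ⟨j, i⟩

/-- The schools in the order of their numbers. -/
def schools : List I.School :=
  (List.finRange _).map .shelter ++ (List.finRange _).map .home ++ (List.finRange _).map .edge

/-- The number of a student. -/
def studentNumber : I.Student → ℕ
  | .vertex v => v
  | .shelterSeat v => I.n + v
  | .edgeSeat e => I.n + I.n + e
  | .color i => I.n + I.n + I.edges.length + i
  | .pair p => I.n + I.n + I.edges.length + h + (numPairs p.1 + p.2)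

/-- The number of a school. -/
def schoolNumber : I.School → ℕ
  | .shelter v => v
  | .home v => I.n + v
  | .edge e => I.n + I.n + e

theorem map_studentNumber_students : I.students.map I.studentNumber =
    List.range (I.n + I.n + I.edges.length + h + numPairs h) := by
  have h1 : ((List.finRange h).flatMap fun j : Fin h => (List.finRange j).map fun i : Fin j =>
      I.n + I.n + I.edges.length + h + (numPairs j + i)) =
      (List.range (numPairs h)).map (I.n + I.n + I.edges.length + h + ·) := by
    rw [← flatMap_numPairs_add, List.map_flatMap, ← flatMap_finRange]
    simp only [List.map_map, ← map_finRange]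
    rfl
  simp only [students, List.map_append, List.map_map, List.map_flatMap, Function.comp_def,
    studentNumber]
  rw [h1, List.range_add, List.range_add, List.range_add, List.range_add,
    map_finRange I.n fun v => v, map_finRange I.n fun v => I.n + v,
    map_finRange _ fun v => I.n + I.n + v, map_finRange _ fun v => I.n + I.n + I.edges.length + v,
    List.map_id']

theorem map_schoolNumber_schools : I.schools.map I.schoolNumber =
    List.range (I.n + I.n + I.edges.length) := by
  simp only [schools, List.map_append, List.map_map, Function.comp_def, schoolNumber]
  rw [List.range_add, List.range_add,
    map_finRange I.n fun v => v, map_finRange I.n fun v => I.n + v,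
    map_finRange _ fun v => I.n + I.n + v, List.map_id']

theorem mem_students (u : I.Student) : u ∈ I.students := by
  cases u with
  | pair p =>
    simp only [students, List.mem_append, List.mem_flatMap, List.mem_map]
    exact .inr ⟨p.1, List.mem_finRange _, p.2, List.mem_finRange _, rfl⟩
  | _ => simp [students]

theorem mem_schools (w : I.School) : w ∈ I.schools := by
  cases w <;> simp [schools]

theorem map_studentPref_students :
    (I.students.map fun u => (I.studentPref u).map I.schoolNumber) =
      MCCProgram.prefs I.colorList I.edgeList h := by
  simp only [students, List.map_append, List.map_map, List.map_flatMap, Function.comp_def,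
    studentPref, schoolNumber, MCCProgram.prefs, length_colorList, length_edgeList,
    ← map_finRange, ← flatMap_finRange, ← map_filter_finRange, List.map_cons, List.map_nil,
    getD_colorList, getD_edgeList, color₁_eq, color₂_eq, mem_colorPairs, ← Fin.ext_iff,
    Bool.decide_or, Bool.decide_and]
  congr 1
  refine List.flatMap_congr fun j _ => List.map_congr_left fun i _ => ?_
  simp only [ColorPair.low, Fin.ext_iff]

theorem map_pair_ofColors (c d : Fin h) :
    ((ColorPair.ofColors c d).map fun p => I.studentNumber (.pair p)) =
      MCCProgram.pairNumber I.colorList I.edgeList h c d := by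
  simp only [MCCProgram.pairNumber, MCCProgram.colorOffset, length_colorList, length_edgeList,
    ColorPair.ofColors, Bool.cond_decide, Fin.lt_def]
  split_ifs <;> simp [studentNumber]

theorem map_schoolPrio_schools :
    (I.schools.map fun w => (I.schoolPrio w).map I.studentNumber) =
      MCCProgram.prios I.colorList I.edgeList h := by
  simp only [schools, List.map_append, List.map_map, Function.comp_def,
    schoolPrio, MCCProgram.prios, length_colorList, length_edgeList,
    ← map_finRange, List.map_cons, List.map_nil,
    getD_colorList, getD_edgeList, color₁_eq, color₂_eq, colorPairs, map_pair_ofColors]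
  simp only [studentNumber, MCCProgram.colorOffset, length_colorList, length_edgeList]

theorem map_one_schools :
    (I.schools.map fun _ => 1) = MCCProgram.caps I.colorList I.edgeList := by
  have h := congrArg List.length I.map_schoolNumber_schools
  simp only [List.length_map, List.length_range] at h
  simp [MCCProgram.caps, MCCProgram.colorOffset, h]

/-- The numbered matching instance: what the program outputs, and when it is a yes-instance. -/
theorem exists_mmInstance (hpref : ∀ u, I.studentPref u ≠ []) :
    ∃ (n m : ℕ) (J : MMInstance (Fin n) (Fin m)),
      J.encode = enc (MCCProgram.prefs I.colorList I.edgeList h,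
        MCCProgram.prios I.colorList I.edgeList h, MCCProgram.caps I.colorList I.edgeList) ∧
      (J.HasSumSP (h.choose 2 + h) ↔ I.HasMultiColoredClique) := by
  classical
  obtain ⟨e, he, hofe⟩ := exists_equiv_of_map_eq_range I.map_studentNumber_students I.mem_students
  obtain ⟨f, hf, hoff⟩ := exists_equiv_of_map_eq_range I.map_schoolNumber_schools I.mem_schools
  let _ : Fintype I.Student := Fintype.ofEquiv _ e.symm
  let _ : Fintype I.School := Fintype.ofEquiv _ f.symm
  have hK : Fintype.card I.Student = Fintype.card I.School + (h.choose 2 + h) := by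
    rw [Fintype.card_congr e, Fintype.card_congr f, Fintype.card_fin, Fintype.card_fin,
      numPairs_eq_choose]
    omega
  refine ⟨_, _, (I.matching hpref).relabel e f, ?_, ?_⟩
  · have h1 : ∀ l : List I.School, (l.map f).map Fin.val = l.map I.schoolNumber := fun l => by
      rw [List.map_map]; exact List.map_congr_left fun w _ => hf w
    have h2 : ∀ l : List I.Student, (l.map e).map Fin.val = l.map I.studentNumber := fun l => by
      rw [List.map_map]; exact List.map_congr_left fun w _ => he w
    rw [← map_studentPref_students, ← map_schoolPrio_schools, ← map_one_schools]
    simp only [MMInstance.encode, MMInstance.relabel, h1, h2]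
    rw [hofe fun u => SExp.ofNats (((I.matching hpref).pref u).map I.schoolNumber),
      hoff fun w => SExp.ofNats (((I.matching hpref).prio w).map I.studentNumber),
      hoff fun w => (I.matching hpref).cap w]
    have hE : ∀ (A B : List (List ℕ)) (C : List ℕ), enc (A, B, C) =
        .cons (.ofList (A.map .ofNats)) (.cons (.ofList (B.map .ofNats)) (.ofNats C)) :=
      fun _ _ _ => rfl
    rw [hE, List.map_map, List.map_map]
    rfl
  · rw [MMInstance.hasSumSP_relabel_iff]
    exact ⟨I.hasMultiColoredClique_of_hasSumSP hpref hK,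
      I.hasSumSP_of_hasMultiColoredClique hpref hK⟩

theorem studentPref_ne_nil_of_hasMultiColoredClique (hC : I.HasMultiColoredClique) (u : I.Student) :
    I.studentPref u ≠ [] := by
  obtain ⟨s, hs, hadj⟩ := I.hasMultiColoredClique_iff.1 hC
  cases u with
  | vertex v => simp [studentPref]
  | shelterSeat v => simp [studentPref]
  | edgeSeat e => simp [studentPref]
  | color i => exact List.ne_nil_of_mem (List.mem_map_of_mem (a := s i) (by simp [hs i]))
  | pair p =>
    obtain ⟨e, he, -⟩ := I.exists_edge_of_clique hs hadj p
    exact List.ne_nil_of_mem (List.mem_map_of_mem (a := e) (by simp [he]))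

end MCCInstance

/-! ### The reduction from Multi-Colored Clique to MinSumSP -/

namespace MCCProgram

/-- Whether a tree encodes a colored graph with `h` colors. -/
def isValid (x : SExp) (h : ℕ) : Bool :=
  !x.toList.isEmpty && (x.left.toList.all fun c => c.isNat && decide (c.toNat < h)) &&
    x.right.toList.all fun e => !e.toList.isEmpty && e.left.isNat && e.right.isNat &&
      decide (e.left.toNat < x.left.toList.length) &&
      decide (e.right.toNat < x.left.toList.length) && !decide (e.left.toNat = e.right.toNat)

/-- The color list of an encoded graph. -/
def decodeColors (x : SExp) : List ℕ := x.left.toList.map SExp.toNat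

/-- The edge list of an encoded graph. -/
def decodeEdges (x : SExp) : List (ℕ × ℕ) :=
  x.right.toList.map fun e => (e.left.toNat, e.right.toNat)

section
variable {α : Type} [Enc α] {x : α → SExp}

@[fun_prop]
theorem polyTime_isValid {h : α → ℕ} (hx : PolyTime x) (hh : PolyTime h) :
    PolyTime fun a => isValid (x a) (h a) := by
  unfold isValid; fun_prop

@[fun_prop]
theorem polyTime_decodeColors (hx : PolyTime x) : PolyTime fun a => decodeColors (x a) := by
  unfold decodeColors; fun_prop

@[fun_prop]
theorem polyTime_decodeEdges (hx : PolyTime x) : PolyTime fun a => decodeEdges (x a) := by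
  unfold decodeEdges; fun_prop

end

theorem decodeColors_encode {h : ℕ} (I : MCCInstance h) :
    decodeColors I.encode = I.colorList := by
  rw [I.encode_eq_enc, decodeColors, SExp.left_enc, SExp.toList_enc, List.map_map]
  exact (List.map_congr_left fun c _ => SExp.toNat_enc c).trans (List.map_id _)

theorem decodeEdges_encode {h : ℕ} (I : MCCInstance h) :
    decodeEdges I.encode = I.edgeList := by
  rw [I.encode_eq_enc, decodeEdges, SExp.right_enc, SExp.toList_enc, List.map_map]
  refine (List.map_congr_left fun e _ => ?_).trans (List.map_id _)
  simp only [Function.comp, SExp.left_enc, SExp.right_enc, SExp.toNat_enc]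
  rfl

theorem isValid_encode {h : ℕ} (I : MCCInstance h) : isValid I.encode h = true := by
  rw [I.encode_eq_enc]
  simp only [isValid, SExp.left_enc, SExp.right_enc, SExp.toList_enc, List.length_map,
    Bool.and_eq_true, List.all_map, List.all_eq_true, Function.comp, SExp.isNat_enc, SExp.toNat_enc,
    true_and, decide_eq_true_eq, MCCInstance.length_colorList, and_true]
  refine ⟨⟨rfl, fun c hc => ?_⟩, fun e he => ?_⟩
  · obtain ⟨v, rfl⟩ := (List.mem_ofFn' _ _).1 hc
    exact (I.color v).2
  · obtain ⟨e, he', rfl⟩ := List.mem_map.1 he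
    refine ⟨⟨⟨rfl, e.1.2⟩, e.2.2⟩, ?_⟩
    simpa [← Fin.ext_iff] using I.edges_ne e he'

theorem exists_encode_eq {x : SExp} {h : ℕ} (hx : isValid x h = true) :
    ∃ I : MCCInstance h, I.encode = x := by
  simp only [isValid, Bool.and_eq_true, List.all_eq_true, decide_eq_true_eq] at hx
  obtain ⟨⟨h1, h2⟩, h3⟩ := hx
  cases x with
  | nil => simp [SExp.toList] at h1
  | cons A B =>
    rw [show (SExp.cons A B).left = A from rfl] at h2 h3
    rw [show (SExp.cons A B).right = B from rfl] at h3
    let I : MCCInstance h :=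
      { n := A.toList.length
        color := fun v => ⟨(A.toList.get v).toNat, (h2 _ (List.get_mem _ v)).2⟩
        edges := B.toList.attach.map fun e =>
          (⟨e.1.left.toNat, (h3 _ e.2).1.1.2⟩, ⟨e.1.right.toNat, (h3 _ e.2).1.2⟩)
        edges_ne := by
          intro e he
          obtain ⟨e, -, rfl⟩ := List.mem_map.1 he
          have := (h3 _ e.2).2
          rw [Bool.not_eq_true', decide_eq_false_iff_not] at this
          exact fun he => this (congrArg Fin.val he) }
    have hc : I.colorList.map enc = A.toList := by
      rw [MCCInstance.colorList, List.map_ofFn]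
      conv_rhs => rw [← List.ofFn_get A.toList]
      congr 1
      funext v
      exact SExp.enc_toNat (h2 _ (List.get_mem _ v)).1
    have he : I.edgeList.map enc = B.toList := by
      rw [MCCInstance.edgeList, List.map_map, List.map_map]
      conv_rhs => rw [← List.attach_map_subtype_val B.toList]
      refine List.map_congr_left fun e _ => ?_
      obtain ⟨⟨⟨⟨⟨h4, h5⟩, h6⟩, -⟩, -⟩, -⟩ := h3 _ e.2
      obtain ⟨e, he⟩ := e
      cases e with
      | nil => simp [SExp.toList] at h4
      | cons a b =>
        change SExp.cons (enc a.toNat) (enc b.toNat) = _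
        rw [SExp.enc_toNat (x := a) h5, SExp.enc_toNat (x := b) h6]
    refine ⟨I, ?_⟩
    rw [I.encode_eq_enc]
    change SExp.cons (.ofList (I.colorList.map enc)) (.ofList (I.edgeList.map enc)) = _
    rw [hc, he]
    have key : ∀ y : SExp, SExp.ofList y.toList = y := fun y => by
      have := SExp.enc_toList y
      rwa [show enc y.toList = SExp.ofList (y.toList.map enc) from rfl,
        show (enc : SExp → SExp) = id from rfl, List.map_id] at this
    rw [key, key]

theorem _root_.MCCInstance.encode_injective {h : ℕ} {I I' : MCCInstance h}
    (he : I.encode = I'.encode) : I = I' := by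
  have h1 : I.colorList = I'.colorList := by rw [← decodeColors_encode, he, decodeColors_encode]
  have h2 : I.edgeList = I'.edgeList := by rw [← decodeEdges_encode, he, decodeEdges_encode]
  obtain ⟨n, color, edges, hI⟩ := I
  obtain ⟨n', color', edges', hI'⟩ := I'
  obtain rfl : n = n' := by simpa using congrArg List.length h1
  obtain rfl : color = color' :=
    funext fun v => Fin.ext (congrFun (List.ofFn_injective h1) v)
  obtain rfl : edges = edges' := List.map_injective_iff.2 (fun e e' h => Prod.ext
    (Fin.ext (Prod.mk.inj h).1) (Fin.ext (Prod.mk.inj h).2)) h2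
  rfl

/-- The instance of MinSumSP constructed from a tree and a number of colors. The output for trees
that encode no colored graph, and for graphs in which a color or a pair of colors does not occur,
is a leaf, which encodes no matching instance. -/
def reduction (x : SExp × ℕ) : SExp × ℕ :=
  (bif isValid x.1 x.2 &&
      ((prefs (decodeColors x.1) (decodeEdges x.1) x.2).all fun l => !l.isEmpty) then
    enc (prefs (decodeColors x.1) (decodeEdges x.1) x.2,
      prios (decodeColors x.1) (decodeEdges x.1) x.2, caps (decodeColors x.1) (decodeEdges x.1))
    else .nil, numPairs x.2 + x.2)

theorem polyTime_reduction : PolyTime reduction := by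
  unfold reduction; fun_prop

theorem mem_iff_reduction_mem (x : SExp) (h : ℕ) :
    (x, h) ∈ MultiColoredClique ↔ reduction (x, h) ∈ MinSumSP := by
  simp only [MultiColoredClique, MinSumSP, reduction, Set.mem_ofPred_eq, numPairs_eq_choose]
  have hpos : 0 < h.choose 2 + h ↔ 0 < h := by
    rcases h with _ | h <;> simp
  rw [hpos]
  refine and_congr_right fun _ => ?_
  cases hv : isValid x h with
  | false =>
    refine iff_of_false ?_ ?_
    · rintro ⟨I, rfl, -⟩
      rw [isValid_encode] at hv
      cases hv
    · rintro ⟨n, m, J, hJ, -⟩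
      cases hJ
  | true =>
    obtain ⟨I, rfl⟩ := exists_encode_eq hv
    simp only [decodeColors_encode, decodeEdges_encode]
    have hall : ((prefs I.colorList I.edgeList h).all fun l => !l.isEmpty) = true ↔
        ∀ u, I.studentPref u ≠ [] := by
      rw [← I.map_studentPref_students]
      simp only [List.all_map, List.all_eq_true, Function.comp]
      exact ⟨fun h u => by simpa using h u (I.mem_students u), fun h u _ => by simpa using h u⟩
    constructor
    · rintro ⟨I', hI', hC⟩
      obtain rfl := MCCInstance.encode_injective hI'
      have hpref := I.studentPref_ne_nil_of_hasMultiColoredClique hC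
      obtain ⟨n, m, J, hJ, hiff⟩ := I.exists_mmInstance hpref
      rw [hall.2 hpref]
      exact ⟨n, m, J, hJ.symm, hiff.2 hC⟩
    · rintro ⟨n, m, J, hJ, hS⟩
      cases hp : (prefs I.colorList I.edgeList h).all fun l => !l.isEmpty with
      | false => rw [hp] at hJ; cases hJ
      | true =>
        obtain ⟨n', m', J', hJ', hiff⟩ := I.exists_mmInstance (hall.1 hp)
        rw [hp] at hJ
        exact ⟨I, rfl, hiff.1 (hS.of_encode_eq (hJ.symm.trans hJ'.symm))⟩

end MCCProgram

theorem polyReduces_multiColoredClique_minSumSP :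
    PolyReducesWithParam MultiColoredClique MinSumSP (fun h => h.choose 2 + h) :=
  .of_polyTime MCCProgram.polyTime_reduction
    (fun _ h => by simp [MCCProgram.reduction, numPairs_eq_choose])
    MCCProgram.mem_iff_reduction_mem

/-! ### From satisfying assignments to colored vertices -/

/-- The lists of length `m` with entries from a given list. -/
def tuples {β : Type} (l : List β) : ℕ → List (List β)
  | 0 => [[]]
  | m + 1 => l.flatMap fun b => (tuples l m).map fun t => b :: t

theorem mem_tuples {β : Type} {l : List β} {m : ℕ} {t : List β} :
    t ∈ tuples l m ↔ t.length = m ∧ ∀ b ∈ t, b ∈ l := by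
  induction m generalizing t with
  | zero => simp only [tuples, List.mem_singleton, List.length_eq_zero_iff]; aesop
  | succ m ih =>
    simp only [tuples, List.mem_flatMap, List.mem_map, ih]
    constructor
    · rintro ⟨b, hb, t, ⟨h1, h2⟩, rfl⟩
      simpa [h1, hb] using h2
    · rintro ⟨h1, h2⟩
      cases t with
      | nil => simp at h1
      | cons b t =>
        exact ⟨b, h2 b (by simp), t, ⟨by simpa using h1, fun c hc => h2 c (by simp [hc])⟩, rfl⟩

theorem length_tuples {β : Type} (l : List β) (m : ℕ) : (tuples l m).length = l.length ^ m := by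
  induction m with
  | zero => rfl
  | succ m ih => simp [tuples, List.length_flatMap, ih, pow_succ, mul_comm]

namespace CNFProgram

/-! In the functions below, a formula over `n` variables is given by the list of its clauses, and
literals are pairs of a variable and a sign. A binding is a pair of a position and a value. -/

section
variable (n q k : ℕ) (F : List (List (ℕ × Bool)))

/-- The clauses whose negated variables all belong to `Y`, while none of their other variables is
the value of a binding in `Z`. -/
def unhit (Y : List ℕ) (Z : List (ℕ × ℕ)) : List (List (ℕ × Bool)) :=
  F.filter fun C => C.all fun l =>
    bif l.2 then !Z.any fun z => decide (z.2 = l.1) else decide (l.1 ∈ Y)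

/-- The variables that occur without negation. -/
def positives (C : List (ℕ × Bool)) : List ℕ := (C.filter fun l => l.2).map fun l => l.1

/-- One step of the search for bindings that hit all clauses: the instruction `(c, p)` binds the
`c`-th positive variable of the first unhit clause to the position `p`. -/
def searchStep (Y : List ℕ) (Z : List (ℕ × ℕ)) (i : ℕ × ℕ) : List (ℕ × ℕ) :=
  (i.2, (positives ((unhit F Y Z).headD [])).getD i.1 n) :: Z

/-- The bindings found by following a list of instructions. -/
def search (Y : List ℕ) (is : List (ℕ × ℕ)) : List (ℕ × ℕ) := is.foldl (searchStep n F Y) []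

/-- The vertices of the colors `0, …, k`: each position gets a value. Position `0` gets the value
`n`, which is not a variable. -/
def positionVertices : List (ℕ × List (ℕ × ℕ)) :=
  (0, [(0, n)]) :: (List.range k).flatMap fun j => (List.range n).map fun v => (j + 1, [(j + 1, v)])

/-- The bindings of the positions in `A` to the values in `Y`. -/
def zipBindings (A Y : List ℕ) : List (ℕ × ℕ) :=
  (List.range q).map fun i => (A.getD i 0, Y.getD i 0)

/-- The tuples of positions. Each of them has a color. -/
def positionTuples : List (List ℕ) := tuples (List.range (k + 1)) q

/-- The vertices of the color of a tuple of positions: values of these positions, and bindings found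
by the search that hit all clauses. -/
def tupleVertices (σ : List (List (ℕ × ℕ))) : List (ℕ × List (ℕ × ℕ)) :=
  (List.range (positionTuples q k).length).flatMap fun a =>
    (tuples (List.range (n + 1)) q).flatMap fun Y =>
      (σ.filter fun is => (unhit F Y (search n F Y is)).isEmpty).map fun is =>
        (k + 1 + a, zipBindings q ((positionTuples q k).getD a []) Y ++ search n F Y is)

/-- All vertices, for a list `σ` of lists of instructions. -/
def vertices (σ : List (List (ℕ × ℕ))) : List (ℕ × List (ℕ × ℕ)) :=
  positionVertices n k ++ tupleVertices n q k F σ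

/-- The number of colors. -/
def numColors : ℕ := k + 1 + (positionTuples q k).length

/-- The instructions that the search may follow. -/
def instructions : List (ℕ × ℕ) :=
  (List.range (q + 1)).flatMap fun c => (List.range (k + 1)).map fun p => (c, p)

/-- Whether the bindings in two lists are compatible: equal positions have equal values, and
different positions have different values. -/
def compatible (B B' : List (ℕ × ℕ)) : Bool :=
  B.all fun b => B'.all fun b' => (decide (b.1 = b'.1) && decide (b.2 = b'.2)) ||
    (!decide (b.1 = b'.1) && !decide (b.2 = b'.2))

end

theorem compatible_iff {B B' : List (ℕ × ℕ)} :
    compatible B B' = true ↔ ∀ b ∈ B, ∀ b' ∈ B', (b.1 = b'.1 ↔ b.2 = b'.2) := by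
  simp only [compatible, List.all_eq_true, Bool.or_eq_true, Bool.and_eq_true, decide_eq_true_eq,
    Bool.not_eq_true', decide_eq_false_iff_not, iff_iff_and_or_not_and_not]

theorem compatible_symm {B B' : List (ℕ × ℕ)} (h : compatible B B' = true) :
    compatible B' B = true := by
  rw [compatible_iff] at h ⊢
  exact fun b hb b' hb' => by have := h b' hb' b hb; tauto

variable {n q k : ℕ} {F : List (List (ℕ × Bool))}

theorem mem_positives {C : List (ℕ × Bool)} {v : ℕ} : v ∈ positives C ↔ (v, true) ∈ C := by
  simp [positives]

theorem mem_unhit {Y : List ℕ} {Z : List (ℕ × ℕ)} {C : List (ℕ × Bool)} :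
    C ∈ unhit F Y Z ↔ C ∈ F ∧ (∀ v, (v, true) ∈ C → ∀ z ∈ Z, z.2 ≠ v) ∧
      ∀ v, (v, false) ∈ C → v ∈ Y := by
  simp only [unhit, List.mem_filter, List.all_eq_true]
  refine and_congr_right fun _ => ⟨fun h => ⟨fun v hv z hz => ?_, fun v hv => ?_⟩, ?_⟩
  · have := h _ hv
    simp only [cond_true, Bool.not_eq_true', List.any_eq_false, decide_eq_true_eq] at this
    exact this z hz
  · simpa using h _ hv
  · rintro ⟨h1, h2⟩ ⟨v, b⟩ hl
    cases b with
    | true => simpa using fun a b hb => h1 v hl (a, b) hb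
    | false => simpa using h2 v hl

/-- Choose a vertex of every color, pairwise compatible. -/
def HasTransversal (Vs : List (ℕ × List (ℕ × ℕ))) (h : ℕ) : Prop :=
  ∃ g : ℕ → List (ℕ × ℕ), (∀ i < h, (i, g i) ∈ Vs) ∧
    ∀ i < h, ∀ j < h, i ≠ j → compatible (g i) (g j) = true

theorem mem_instructions {i : ℕ × ℕ} : i ∈ instructions q k ↔ i.1 ≤ q ∧ i.2 ≤ k := by
  simp only [instructions, List.mem_flatMap, List.mem_map, List.mem_range]
  constructor
  · rintro ⟨c, hc, p, hp, rfl⟩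
    exact ⟨by omega, by omega⟩
  · rintro ⟨h1, h2⟩
    exact ⟨i.1, by omega, i.2, by omega, rfl⟩

theorem fst_le_of_mem_search {Y : List ℕ} {is : List (ℕ × ℕ)} {b : ℕ × ℕ}
    (hb : b ∈ search n F Y is) : ∃ i ∈ is, b.1 = i.2 := by
  induction is using List.reverseRecOn with
  | nil => simp [search] at hb
  | append_singleton is i ih =>
    simp only [search, List.foldl_append, List.foldl_cons, List.foldl_nil] at hb ih
    rcases List.mem_cons.1 hb with rfl | hb
    · exact ⟨i, by simp, rfl⟩
    · obtain ⟨j, hj, h⟩ := ih hb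
      exact ⟨j, by simp [hj], h⟩

theorem mem_tupleVertices {σ : List (List (ℕ × ℕ))} {x : ℕ × List (ℕ × ℕ)} :
    x ∈ tupleVertices n q k F σ ↔ ∃ a < (positionTuples q k).length,
      ∃ Y ∈ tuples (List.range (n + 1)) q, ∃ is ∈ σ, unhit F Y (search n F Y is) = [] ∧
      x = (k + 1 + a, zipBindings q ((positionTuples q k).getD a []) Y ++ search n F Y is) := by
  simp only [tupleVertices, List.mem_flatMap, List.mem_map, List.mem_filter, List.mem_range,
    List.isEmpty_iff, and_assoc]
  simp only [eq_comm]

theorem mem_positionVertices {x : ℕ × List (ℕ × ℕ)} :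
    x ∈ positionVertices n k ↔ x = (0, [(0, n)]) ∨
      ∃ j < k, ∃ v < n, x = (j + 1, [(j + 1, v)]) := by
  simp only [positionVertices, List.mem_cons, List.mem_flatMap, List.mem_map, List.mem_range,
    eq_comm]

theorem positionTuples_getD_mem {a : ℕ} (ha : a < (positionTuples q k).length) :
    (positionTuples q k).getD a [] ∈ tuples (List.range (k + 1)) q := by
  rw [List.getD_eq_getElem _ _ ha]
  exact List.getElem_mem ha

theorem mem_zipBindings {A Y : List ℕ} {b : ℕ × ℕ} :
    b ∈ zipBindings q A Y ↔ ∃ i < q, b = (A.getD i 0, Y.getD i 0) := by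
  simp only [zipBindings, List.mem_map, List.mem_range, eq_comm]

/-- The vertices chosen for the positions define the true variables. The vertices chosen for tuples
of positions make sure that no clause is violated, since the negated variables of a violated clause
would be the values of some tuple of positions. -/
theorem exists_finset_of_hasTransversal (hvar : ∀ C ∈ F, ∀ l ∈ C, l.1 < n)
    (hlen : ∀ C ∈ F, C.length ≤ q)
    (h : HasTransversal (vertices n q k F (tuples (instructions q k) k)) (numColors q k)) :
    ∃ S : Finset ℕ, (∀ v ∈ S, v < n) ∧ S.card = k ∧
      ∀ C ∈ F, ∃ l ∈ C, (l.1 ∈ S ↔ l.2 = true) := by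
  obtain ⟨g, hg, hgc⟩ := h
  -- the values of the positions
  have hpos : ∀ p, ∃ v, p ≤ k → g p = [(p, v)] ∧ (p = 0 → v = n) ∧ (p ≠ 0 → v < n) := by
    intro p
    by_cases hp : p ≤ k
    · have := hg p (by unfold numColors; omega)
      rcases List.mem_append.1 this with h1 | h1
      · rcases mem_positionVertices.1 h1 with h1 | ⟨j, hj, v, hv, h1⟩
        · obtain ⟨rfl, h2⟩ := Prod.mk.inj h1
          exact ⟨n, fun _ => ⟨h2, by simp, by simp⟩⟩
        · obtain ⟨rfl, h2⟩ := Prod.mk.inj h1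
          exact ⟨v, fun _ => ⟨h2, by simp, fun _ => hv⟩⟩
      · obtain ⟨a, -, Y, -, is, -, -, h2⟩ := mem_tupleVertices.1 h1
        have := (Prod.mk.inj h2).1
        omega
    · exact ⟨0, fun h => absurd h hp⟩
  choose s hs using hpos
  have hinj : ∀ p ≤ k, ∀ p' ≤ k, s p = s p' → p = p' := by
    intro p hp p' hp' h
    by_contra hne
    have := hgc p (by unfold numColors; omega) p' (by unfold numColors; omega) hne
    rw [(hs p hp).1, (hs p' hp').1, compatible_iff] at this
    exact hne ((this (p, s p) (by simp) (p', s p') (by simp)).2 h)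
  refine ⟨(Finset.Icc 1 k).image s, ?_, ?_, ?_⟩
  · intro v hv
    obtain ⟨p, hp, rfl⟩ := Finset.mem_image.1 hv
    rw [Finset.mem_Icc] at hp
    exact (hs p hp.2).2.2 (by omega)
  · rw [Finset.card_image_of_injOn, Nat.card_Icc]
    · omega
    · intro p hp p' hp' h
      simp only [Finset.coe_Icc, Set.mem_Icc] at hp hp'
      exact hinj p hp.2 p' hp'.2 h
  · intro C hC
    by_contra hcon
    push Not at hcon
    have hfalse : ∀ v, (v, false) ∈ C → ∃ p ∈ Finset.Icc 1 k, s p = v := by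
      intro v hv
      have := hcon _ hv
      simpa using this
    have htrue : ∀ v, (v, true) ∈ C → ∀ p ∈ Finset.Icc 1 k, s p ≠ v := by
      intro v hv p hp he
      have := hcon _ hv
      simp only [Finset.mem_image, not_exists, not_and] at this
      rcases this with ⟨h1, h2⟩ | ⟨h1, h2⟩
      · exact h2 rfl
      · exact h1 p hp he
    -- the tuple of the positions of the negated variables, filled up with the position `0`
    have : ∀ v, ∃ p, (v, false) ∈ C → p ∈ Finset.Icc 1 k ∧ s p = v := fun v => by
      by_cases hv : (v, false) ∈ C
      · obtain ⟨p, hp⟩ := hfalse v hv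
        exact ⟨p, fun _ => hp⟩
      · exact ⟨0, fun h => absurd h hv⟩
    choose pos hposv using this
    let A₀ : List ℕ := (C.filter fun l => !l.2).map fun l => pos l.1
    have hA₀ : A₀.length ≤ q := by
      simp only [A₀, List.length_map]
      exact (List.length_filter_le _ _).trans (hlen C hC)
    let A : List ℕ := A₀ ++ List.replicate (q - A₀.length) 0
    have hA : A ∈ positionTuples q k := by
      refine mem_tuples.2 ⟨by simp [A]; omega, fun p hp => ?_⟩
      rw [List.mem_range]
      rcases List.mem_append.1 hp with hp | hp
      · obtain ⟨⟨v, b⟩, hl, rfl⟩ := List.mem_map.1 hp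
        obtain ⟨hl, hb⟩ := List.mem_filter.1 hl
        have hb : b = false := by simpa using hb
        subst hb
        have := Finset.mem_Icc.1 (hposv v hl).1
        change pos v < _
        omega
      · rw [List.eq_of_mem_replicate hp]; omega
    obtain ⟨a, ha, hAa⟩ := List.mem_iff_getElem.1 hA
    have hmem := hg (k + 1 + a) (by unfold numColors; omega)
    rcases List.mem_append.1 hmem with h1 | h1
    · rcases mem_positionVertices.1 h1 with h1 | ⟨j, hj, v, hv, h1⟩
      · have := (Prod.mk.inj h1).1; omega
      · have := (Prod.mk.inj h1).1; omega
    obtain ⟨a', ha', Y, hY, is, his, hun, h2⟩ := mem_tupleVertices.1 h1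
    obtain ⟨h3, h4⟩ := Prod.mk.inj h2
    obtain rfl : a = a' := by omega
    rw [List.getD_eq_getElem _ _ ha, hAa] at h4
    have hbind : ∀ b ∈ g (k + 1 + a), b.1 ≤ k → b.2 = s b.1 := by
      intro b hb hbk
      have := hgc (k + 1 + a) (by unfold numColors; omega) b.1 (by unfold numColors; omega)
        (by omega)
      rw [(hs b.1 hbk).1, compatible_iff] at this
      exact (this b hb (b.1, s b.1) (by simp)).1 rfl
    have hnone : C ∉ unhit F Y (search n F Y is) := by rw [hun]; simp
    refine hnone (mem_unhit.2 ⟨hC, fun v hv z hz he => ?_, fun v hv => ?_⟩)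
    · obtain ⟨i, hi, hzi⟩ := fst_le_of_mem_search hz
      have hik := (mem_instructions.1 ((mem_tuples.1 his).2 i hi)).2
      have hz2 := hbind z (by rw [h4]; exact List.mem_append_right _ hz) (by omega)
      have hvn := hvar C hC _ hv
      by_cases h0 : z.1 = 0
      · have := (hs z.1 (by omega)).2.1 h0
        dsimp only at hvn
        omega
      · exact htrue v hv z.1 (Finset.mem_Icc.2 ⟨by omega, by omega⟩) (by rw [← hz2, he])
    · have hposA : pos v ∈ A := List.mem_append_left _
        (List.mem_map.2 ⟨(v, false), List.mem_filter.2 ⟨hv, rfl⟩, rfl⟩)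
      obtain ⟨i, hi, hAi⟩ := List.mem_iff_getElem.1 hposA
      have hiq : i < q := by have := (mem_tuples.1 hA).1; omega
      have hiY : i < Y.length := by rw [(mem_tuples.1 hY).1]; exact hiq
      have := hbind (A.getD i 0, Y.getD i 0) (by
        rw [h4]; exact List.mem_append_left _ (mem_zipBindings.2 ⟨i, hiq, rfl⟩)) (by
        rw [List.getD_eq_getElem _ _ hi, hAi]
        exact (Finset.mem_Icc.1 (hposv v hv).1).2)
      rw [List.getD_eq_getElem _ _ hi, hAi, List.getD_eq_getElem _ _ hiY] at this
      have h5 : Y[i] = v := this.trans (hposv v hv).2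
      rw [← h5]
      exact List.getElem_mem hiY

/-- Following suitable instructions, the search finds bindings that are correct for a satisfying
assignment and hit all clauses: as long as a clause is unhit, one of its positive variables is true,
and this variable has not been bound before. -/
theorem exists_instructions {S : Finset ℕ} {s : ℕ → ℕ} {Y : List ℕ} (hlen : ∀ C ∈ F, C.length ≤ q)
    (hsat : ∀ C ∈ F, ∃ l ∈ C, (l.1 ∈ S ↔ l.2 = true)) (hs0 : s 0 = n)
    (hsS : ∀ v ∈ S, ∃ p ≤ k, s p = v) (hY : ∀ C ∈ F, ∀ v, (v, false) ∈ C → v ∈ Y → v ∈ S) (m : ℕ) :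
    ∃ is ∈ tuples (instructions q k) m, (∀ b ∈ search n F Y is, b.1 ≤ k ∧ b.2 = s b.1) ∧
      (unhit F Y (search n F Y is) = [] ∨
        m ≤ (S.filter fun v => ∃ b ∈ search n F Y is, b.2 = v).card) := by
  induction m with
  | zero => exact ⟨[], by simp [tuples], by simp [search], .inr (Nat.zero_le _)⟩
  | succ m ih =>
    obtain ⟨is, his, hb, hm⟩ := ih
    have hnew : ∀ i, search n F Y (is ++ [i]) = searchStep n F Y (search n F Y is) i := fun i => by
      simp [search]
    have htup : ∀ i : ℕ × ℕ, i.1 ≤ q → i.2 ≤ k → is ++ [i] ∈ tuples (instructions q k) (m + 1) := by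
      intro i h1 h2
      obtain ⟨h3, h4⟩ := mem_tuples.1 his
      refine mem_tuples.2 ⟨by simp [h3], fun j hj => ?_⟩
      rcases List.mem_append.1 hj with hj | hj
      · exact h4 j hj
      · rw [List.mem_singleton.1 hj]; exact mem_instructions.2 ⟨h1, h2⟩
    cases hun : unhit F Y (search n F Y is) with
    | nil =>
      -- nothing is left to do; the next instruction binds the position `0` to its value
      refine ⟨is ++ [(0, 0)], htup _ (Nat.zero_le _) (Nat.zero_le _), ?_, .inl ?_⟩
      · intro b hbs
        rw [hnew, searchStep, hun] at hbs
        rcases List.mem_cons.1 hbs with rfl | hbs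
        · exact ⟨Nat.zero_le _, by simp [positives, hs0]⟩
        · exact hb b hbs
      · refine List.eq_nil_iff_forall_not_mem.2 fun C hC => ?_
        rw [hnew, searchStep] at hC
        obtain ⟨h1, h2, h3⟩ := mem_unhit.1 hC
        have : C ∈ unhit F Y (search n F Y is) :=
          mem_unhit.2 ⟨h1, fun v hv z hz => h2 v hv z (List.mem_cons_of_mem _ hz), h3⟩
        rw [hun] at this
        simp at this
    | cons C T =>
      rw [hun] at hm
      replace hm := hm.resolve_left (by simp)
      have hC : C ∈ unhit F Y (search n F Y is) := by rw [hun]; simp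
      obtain ⟨hCF, h2, h3⟩ := mem_unhit.1 hC
      obtain ⟨⟨v, b⟩, hl, hiff⟩ := hsat C hCF
      have hb' : b = true := by
        cases b with
        | true => rfl
        | false => exact absurd (hiff.1 (hY C hCF v hl (h3 v hl))) (by simp)
      subst hb'
      have hvS : v ∈ S := hiff.2 rfl
      obtain ⟨p, hp, hpv⟩ := hsS v hvS
      obtain ⟨c, hc, hcv⟩ := List.mem_iff_getElem.1 (mem_positives.2 hl)
      have hcq : c ≤ q := by
        have h4 : (positives C).length ≤ C.length := by
          simp only [positives, List.length_map]
          exact List.length_filter_le _ _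
        have := hlen C hCF
        omega
      have hstep : search n F Y (is ++ [(c, p)]) = (p, v) :: search n F Y is := by
        rw [hnew, searchStep, hun]
        simp only [List.headD_cons]
        rw [List.getD_eq_getElem _ _ hc, hcv]
      refine ⟨is ++ [(c, p)], htup _ hcq hp, ?_, .inr ?_⟩
      · intro b hbs
        rw [hstep] at hbs
        rcases List.mem_cons.1 hbs with rfl | hbs
        · exact ⟨hp, hpv.symm⟩
        · exact hb b hbs
      · rw [hstep]
        refine (Nat.succ_le_succ hm).trans ?_
        rw [Nat.succ_eq_add_one, ← Finset.card_insert_of_notMem (a := v)]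
        · refine Finset.card_le_card fun w hw => ?_
          rcases Finset.mem_insert.1 hw with rfl | hw
          · exact Finset.mem_filter.2 ⟨hvS, (p, w), by simp, rfl⟩
          · obtain ⟨h5, b, h6, h7⟩ := Finset.mem_filter.1 hw
            exact Finset.mem_filter.2 ⟨h5, b, List.mem_cons_of_mem _ h6, h7⟩
        · intro hv
          obtain ⟨-, b, h6, h7⟩ := Finset.mem_filter.1 hv
          exact h2 v hl b h6 h7

theorem hasTransversal_of_finset (hvar : ∀ C ∈ F, ∀ l ∈ C, l.1 < n)
    (hlen : ∀ C ∈ F, C.length ≤ q) {S : Finset ℕ} (hSn : ∀ v ∈ S, v < n) (hcard : S.card = k)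
    (hsat : ∀ C ∈ F, ∃ l ∈ C, (l.1 ∈ S ↔ l.2 = true)) :
    HasTransversal (vertices n q k F (tuples (instructions q k) k)) (numColors q k) := by
  let s : ℕ → ℕ := fun p => (n :: S.toList).getD p 0
  have hlenS : (n :: S.toList).length = k + 1 := by simp [hcard]
  have hnd : (n :: S.toList).Nodup := by
    refine List.nodup_cons.2 ⟨fun h => ?_, S.nodup_toList⟩
    exact lt_irrefl _ (hSn n (Finset.mem_toList.1 h))
  have hs : ∀ p (hp : p ≤ k), s p = (n :: S.toList)[p]'(by omega) := fun p hp =>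
    List.getD_eq_getElem _ _ _
  have hinj : ∀ p ≤ k, ∀ p' ≤ k, s p = s p' → p = p' := by
    intro p hp p' hp' h
    rw [hs p hp, hs p' hp'] at h
    exact (hnd.getElem_inj_iff).1 h
  have hs0 : s 0 = n := rfl
  have hsS : ∀ v ∈ S, ∃ p ≤ k, s p = v := by
    intro v hv
    obtain ⟨p, hp, h⟩ := List.mem_iff_getElem.1
      (List.mem_cons_of_mem n (Finset.mem_toList.2 hv))
    exact ⟨p, by omega, by rw [hs p (by omega)]; exact h⟩
  have hspos : ∀ j < k, s (j + 1) ∈ S := by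
    intro j hj
    rw [hs (j + 1) (by omega), List.getElem_cons_succ]
    exact Finset.mem_toList.1 (List.getElem_mem _)
  have hsn : ∀ p ≤ k, s p < n + 1 := by
    intro p hp
    cases p with
    | zero => rw [hs0]; omega
    | succ j => exact (hSn _ (hspos j (by omega))).trans (by omega)
  -- every color has a vertex all of whose bindings are correct
  have hex : ∀ i, ∃ B, i < numColors q k → (i, B) ∈ vertices n q k F (tuples (instructions q k) k) ∧
      ∀ b ∈ B, b.1 ≤ k ∧ b.2 = s b.1 := by
    intro i
    by_cases hi : i < numColors q k
    swap
    · exact ⟨[], fun h => absurd h hi⟩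
    by_cases hik : i ≤ k
    · refine ⟨[(i, s i)], fun _ => ⟨List.mem_append_left _ (mem_positionVertices.2 ?_), ?_⟩⟩
      · cases i with
        | zero => left; rw [hs0]
        | succ j => exact .inr ⟨j, by omega, s (j + 1), hSn _ (hspos j (by omega)), rfl⟩
      · intro b hb
        rw [List.mem_singleton.1 hb]
        exact ⟨hik, rfl⟩
    · have ha : i - (k + 1) < (positionTuples q k).length := by unfold numColors at hi; omega
      have hA := positionTuples_getD_mem ha
      set A := (positionTuples q k).getD (i - (k + 1)) [] with hAdef
      obtain ⟨hAlen, hAk⟩ := mem_tuples.1 hA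
      have hYF : ∀ C ∈ F, ∀ v, (v, false) ∈ C → v ∈ A.map s → v ∈ S := by
        intro C hC v hv hvA
        obtain ⟨p, hp, rfl⟩ := List.mem_map.1 hvA
        have hpk := List.mem_range.1 (hAk p hp)
        cases p with
        | zero => exact absurd (hvar C hC _ hv) (by rw [hs0]; exact lt_irrefl n)
        | succ j => exact hspos j (by omega)
      obtain ⟨is, his, hb, hun⟩ := exists_instructions (Y := A.map s) hlen hsat hs0 hsS hYF k
      refine ⟨zipBindings q A (A.map s) ++ search n F (A.map s) is, fun _ =>
        ⟨List.mem_append_right _ (mem_tupleVertices.2 ⟨i - (k + 1), ha, A.map s, ?_, is, his, ?_,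
          ?_⟩), ?_⟩⟩
      · refine mem_tuples.2 ⟨by simpa using hAlen, fun v hv => ?_⟩
        obtain ⟨p, hp, rfl⟩ := List.mem_map.1 hv
        have hpk := List.mem_range.1 (hAk p hp)
        exact List.mem_range.2 (hsn p (by omega))
      · rcases hun with hun | hun
        · exact hun
        · -- all true variables have been bound
          have hall : (S.filter fun v => ∃ b ∈ search n F (A.map s) is, b.2 = v) = S :=
            Finset.eq_of_subset_of_card_le (Finset.filter_subset _ _) (by omega)
          refine List.eq_nil_iff_forall_not_mem.2 fun C hC => ?_
          obtain ⟨hCF, h2, h3⟩ := mem_unhit.1 hC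
          obtain ⟨⟨v, b⟩, hl, hiff⟩ := hsat C hCF
          cases b with
          | false => exact absurd (hiff.1 (hYF C hCF v hl (h3 v hl))) (by simp)
          | true =>
            have hv : v ∈ S := hiff.2 rfl
            rw [← hall] at hv
            obtain ⟨-, b, h6, h7⟩ := Finset.mem_filter.1 hv
            exact h2 v hl b h6 h7
      · rw [← hAdef, show k + 1 + (i - (k + 1)) = i by omega]
      · intro b hbB
        rcases List.mem_append.1 hbB with hbB | hbB
        · obtain ⟨j, hj, rfl⟩ := mem_zipBindings.1 hbB
          have hjA : j < A.length := by omega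
          rw [List.getD_eq_getElem _ _ hjA, List.getD_eq_getElem _ _ (by simpa using hjA)]
          have := List.mem_range.1 (hAk _ (List.getElem_mem hjA))
          exact ⟨by omega, by simp⟩
        · exact hb b hbB
  choose g hg using hex
  refine ⟨g, fun i hi => (hg i hi).1, fun i hi j hj _ => compatible_iff.2 fun b hb b' hb' => ?_⟩
  obtain ⟨h1, h2⟩ := (hg i hi).2 b hb
  obtain ⟨h3, h4⟩ := (hg j hj).2 b' hb'
  rw [h2, h4]
  exact ⟨fun h => by rw [h], hinj _ h1 _ h3⟩

theorem fst_lt_of_mem_vertices {σ : List (List (ℕ × ℕ))} {x : ℕ × List (ℕ × ℕ)}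
    (hx : x ∈ vertices n q k F σ) : x.1 < numColors q k := by
  unfold numColors
  rcases List.mem_append.1 hx with h1 | h1
  · rcases mem_positionVertices.1 h1 with rfl | ⟨j, hj, v, hv, rfl⟩
    · dsimp only; omega
    · dsimp only; omega
  · obtain ⟨a, ha, Y, -, is, -, -, rfl⟩ := mem_tupleVertices.1 h1
    dsimp only; omega

end CNFProgram

namespace CNFProgram

/-! ### Computing the colored graph -/

section
variable (Vs : List (ℕ × List (ℕ × ℕ)))

/-- The colors of the vertices. -/
def graphColors : List ℕ := Vs.map fun x => x.1

/-- Whether the vertices with the numbers `a` and `b` have different colors and compatible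
bindings. -/
def isEdge (a b : ℕ) : Bool :=
  !decide ((Vs.getD a (0, [])).1 = (Vs.getD b (0, [])).1) &&
    compatible (Vs.getD a (0, [])).2 (Vs.getD b (0, [])).2

/-- The edges between compatible vertices of different colors. -/
def graphEdges : List (ℕ × ℕ) :=
  (List.range Vs.length).flatMap fun a =>
    ((List.range Vs.length).filter fun b => isEdge Vs a b).map fun b => (a, b)

theorem isEdge_symm {a b : ℕ} (h : isEdge Vs a b = true) : isEdge Vs b a = true := by
  simp only [isEdge, Bool.and_eq_true, Bool.not_eq_true', decide_eq_false_iff_not] at h ⊢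
  exact ⟨fun h' => h.1 h'.symm, compatible_symm h.2⟩

theorem ne_of_isEdge {a b : ℕ} (h : isEdge Vs a b = true) : a ≠ b := by
  rintro rfl
  simp [isEdge] at h

variable {Vs} in
/-- The colored graph of a list of vertices. -/
abbrev graphInstance {h : ℕ} (hV : ∀ x ∈ Vs, x.1 < h) : MCCInstance h where
  n := Vs.length
  color v := ⟨(Vs.get v).1, hV _ (Vs.get_mem v)⟩
  edges := (List.finRange Vs.length).flatMap fun a : Fin Vs.length =>
    ((List.finRange Vs.length).filter fun b : Fin Vs.length => isEdge Vs a b).map fun b => (a, b)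
  edges_ne e he := by
    simp only [List.mem_flatMap, List.mem_map, List.mem_filter] at he
    obtain ⟨a, -, b, ⟨-, hab⟩, rfl⟩ := he
    exact fun h => ne_of_isEdge Vs hab (congrArg Fin.val h)

variable {Vs} {h : ℕ} (hV : ∀ x ∈ Vs, x.1 < h)

theorem encode_graphInstance :
    (graphInstance hV).encode = enc (graphColors Vs, graphEdges Vs) := by
  rw [MCCInstance.encode_eq_enc]
  have h1 : (graphInstance hV).colorList = graphColors Vs := by
    simp only [MCCInstance.colorList, graphInstance, graphColors]
    exact List.ofFn_getElem_eq_map Vs fun x => x.1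
  have h2 : (graphInstance hV).edgeList = graphEdges Vs := by
    simp only [MCCInstance.edgeList, graphInstance, graphEdges, List.map_flatMap, List.map_map,
      Function.comp_def]
    rw [← flatMap_finRange]
    refine List.flatMap_congr fun a _ => ?_
    exact map_filter_finRange Vs.length (fun b => isEdge Vs a b) fun b => ((a : ℕ), b)
  rw [h1, h2]

theorem graphInstance_adj (a b : Fin Vs.length) :
    (graphInstance hV).graph.Adj a b ↔ isEdge Vs a b = true := by
  have hmem : ∀ a b : Fin Vs.length, (a, b) ∈ (graphInstance hV).edges ↔ isEdge Vs a b = true := by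
    intro a b
    simp only [graphInstance, List.mem_flatMap, List.mem_map, List.mem_filter, List.mem_finRange,
      true_and, Prod.mk.injEq]
    constructor
    · rintro ⟨a', b', h, rfl, rfl⟩; exact h
    · intro h; exact ⟨a, b, h, rfl, rfl⟩
  rw [MCCInstance.graph, SimpleGraph.fromRel_adj]
  constructor
  · rintro ⟨-, h | h⟩
    · exact (hmem a b).1 h
    · exact isEdge_symm Vs ((hmem b a).1 h)
  · intro h
    exact ⟨fun he => ne_of_isEdge Vs h (congrArg Fin.val he), .inl ((hmem a b).2 h)⟩

theorem graphInstance_hasMultiColoredClique_iff :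
    (graphInstance hV).HasMultiColoredClique ↔ HasTransversal Vs h := by
  have hgetD : ∀ a : Fin Vs.length, Vs.getD a (0, []) = Vs.get a := fun a => by simp
  rw [MCCInstance.hasMultiColoredClique_iff]
  constructor
  · rintro ⟨s, hs, hadj⟩
    refine ⟨fun i => if hi : i < h then (Vs.get (s ⟨i, hi⟩)).2 else [], ?_, ?_⟩
    · intro i hi
      have h1 : (Vs.get (s ⟨i, hi⟩)).1 = i := congrArg Fin.val (hs ⟨i, hi⟩)
      have h2 := Vs.get_mem (s ⟨i, hi⟩)
      simp only [dif_pos hi]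
      convert h2 using 1
      exact Prod.ext h1.symm rfl
    · intro i hi j hj hij
      simp only [dif_pos hi, dif_pos hj]
      have := (graphInstance_adj hV _ _).1
        (hadj ⟨i, hi⟩ ⟨j, hj⟩ fun h => hij (congrArg Fin.val h))
      simp only [isEdge, Bool.and_eq_true, hgetD] at this
      exact this.2
  · rintro ⟨g, hg, hc⟩
    have : ∀ i : Fin h, ∃ a : Fin Vs.length, Vs.get a = ((i : ℕ), g i) := fun i =>
      List.mem_iff_get.1 (hg i i.2)
    choose s hs using this
    refine ⟨s, fun i => Fin.ext (congrArg Prod.fst (hs i)), fun i j hij => ?_⟩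
    have hij' : (i : ℕ) ≠ j := fun h => hij (Fin.ext h)
    refine (graphInstance_adj hV (s i) (s j)).2 ?_
    simp only [isEdge, Bool.and_eq_true, Bool.not_eq_true', decide_eq_false_iff_not, hgetD, hs]
    exact ⟨hij', hc i i.2 j j.2 hij'⟩

end

/-! ### Reading formulas -/

/-- Whether a tree encodes a formula with at most `q` literals per clause. -/
def isValid (q : ℕ) (x : SExp) : Bool :=
  !x.toList.isEmpty && x.left.isNat && x.right.toList.all fun C =>
    decide (C.toList.length ≤ q) && C.toList.all fun l =>
      !l.toList.isEmpty && l.left.isNat && decide (l.left.toNat < x.left.toNat) &&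
        (l.right.toList.isEmpty || (!l.right.toList.isEmpty && l.right.left.toList.isEmpty &&
          l.right.right.toList.isEmpty))

/-- The clauses of an encoded formula. -/
def decodeClauses (x : SExp) : List (List (ℕ × Bool)) :=
  x.right.toList.map fun C => C.toList.map fun l => (l.left.toNat, !l.right.toList.isEmpty)

/-- The clauses of a formula, with variables as numbers. -/
def clauses {n : ℕ} (F : CNFFormula n) : List (List (ℕ × Bool)) :=
  F.map fun C => C.map fun l => ((l.1 : ℕ), l.2)

theorem encode_eq_enc {n : ℕ} (F : CNFFormula n) : F.encode = enc (n, clauses F) := by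
  have : ∀ l : List (List (ℕ × Bool)), enc l = .ofList (l.map fun C => .ofList (C.map enc)) :=
    fun _ => rfl
  rw [enc_pair, this, clauses, List.map_map]
  simp only [Function.comp_def, List.map_map]
  rfl

theorem toNat_left_encode {n : ℕ} (F : CNFFormula n) : F.encode.left.toNat = n := by
  rw [encode_eq_enc, SExp.left_enc, SExp.toNat_enc]

theorem decodeClauses_encode {n : ℕ} (F : CNFFormula n) : decodeClauses F.encode = clauses F := by
  rw [encode_eq_enc, decodeClauses, SExp.right_enc, SExp.toList_enc, List.map_map]
  refine (List.map_congr_left fun C _ => ?_).trans (List.map_id _)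
  rw [Function.comp, SExp.toList_enc, List.map_map]
  refine (List.map_congr_left fun l _ => ?_).trans (List.map_id _)
  obtain ⟨v, b⟩ := l
  simp only [Function.comp, SExp.left_enc, SExp.right_enc, SExp.toNat_enc]
  cases b <;> rfl

theorem mem_clauses {n : ℕ} {F : CNFFormula n} {C : List (ℕ × Bool)} :
    C ∈ clauses F ↔ ∃ C' ∈ F, C'.map (fun l => ((l.1 : ℕ), l.2)) = C := by
  simp [clauses]

theorem isValid_encode {n q : ℕ} (F : CNFFormula n) (hF : ∀ C ∈ F, C.length ≤ q) :
    isValid q F.encode = true := by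
  rw [encode_eq_enc]
  simp only [isValid, SExp.left_enc, SExp.right_enc, SExp.toList_enc, Bool.and_eq_true,
    List.all_map, List.all_eq_true, Function.comp, SExp.isNat_enc, SExp.toNat_enc,
    decide_eq_true_eq, List.length_map, and_true]
  refine ⟨rfl, fun C hC => ?_⟩
  obtain ⟨C, hCF, rfl⟩ := mem_clauses.1 hC
  refine ⟨by simpa using hF C hCF, fun l hl => ?_⟩
  obtain ⟨⟨v, b⟩, -, rfl⟩ := List.mem_map.1 hl
  refine ⟨⟨rfl, v.2⟩, ?_⟩
  cases b <;> rfl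

theorem exists_encode_eq {q : ℕ} {x : SExp} (hx : isValid q x = true) :
    ∃ (n : ℕ) (F : CNFFormula n), F.encode = x ∧ ∀ C ∈ F, C.length ≤ q := by
  simp only [isValid, Bool.and_eq_true, List.all_eq_true, decide_eq_true_eq] at hx
  obtain ⟨⟨h1, h2⟩, h3⟩ := hx
  cases x with
  | nil => simp [SExp.toList] at h1
  | cons A B =>
    rw [show (SExp.cons A B).left = A from rfl] at h2 h3
    rw [show (SExp.cons A B).right = B from rfl] at h3
    let F : CNFFormula A.toNat := B.toList.attach.map fun C => C.1.toList.attach.map fun l =>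
      (⟨l.1.left.toNat, ((h3 _ C.2).2 _ l.2).1.2⟩, !l.1.right.toList.isEmpty)
    refine ⟨A.toNat, F, ?_, ?_⟩
    · have key : ∀ y : SExp, SExp.ofList y.toList = y := fun y => by
        have := SExp.enc_toList y
        rwa [show enc y.toList = SExp.ofList (y.toList.map enc) from rfl,
          show (enc : SExp → SExp) = id from rfl, List.map_id] at this
      rw [CNFFormula.encode, show SExp.ofNat A.toNat = A from SExp.enc_toNat h2]
      congr 1
      conv_rhs => rw [← key B, ← List.attach_map_subtype_val B.toList]
      rw [List.map_map]
      refine congrArg _ (List.map_congr_left fun C _ => ?_)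
      simp only [Function.comp, List.map_map]
      conv_rhs => rw [← key C.1, ← List.attach_map_subtype_val C.1.toList]
      refine congrArg _ (List.map_congr_left fun l _ => ?_)
      obtain ⟨⟨⟨h4, h5⟩, -⟩, h6⟩ := (h3 _ C.2).2 _ l.2
      obtain ⟨l, hl⟩ := l
      cases l with
      | nil => simp [SExp.toList] at h4
      | cons a b =>
        change SExp.cons (SExp.ofNat a.toNat) (SExp.ofBool !b.toList.isEmpty) = SExp.cons a b
        rw [show SExp.ofNat a.toNat = a from SExp.enc_toNat h5]
        congr 1
        change (b.toList.isEmpty || (!b.toList.isEmpty && b.left.toList.isEmpty &&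
          b.right.toList.isEmpty)) = true at h6
        rcases b with _ | ⟨_ | _, _ | _⟩
        · rfl
        · rfl
        · simp [SExp.toList, SExp.left, SExp.right] at h6
        · simp [SExp.toList, SExp.left, SExp.right] at h6
        · simp [SExp.toList, SExp.left, SExp.right] at h6
    · intro C hC
      obtain ⟨C, -, rfl⟩ := List.mem_map.1 hC
      simpa using (h3 _ C.2).1

/-! ### The reduction from Weighted CNF-Satisfiability to Multi-Colored Clique -/

/-- The vertices of the graph constructed from an encoded formula. -/
def formulaVertices (q : ℕ) (x : SExp) (k : ℕ) (σ : List (List (ℕ × ℕ))) :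
    List (ℕ × List (ℕ × ℕ)) :=
  vertices x.left.toNat q k (decodeClauses x) σ

/-- The instance of Multi-Colored Clique constructed from a tree, a number `k` and a list of lists
of instructions. The output for trees that encode no admissible formula is a leaf, which encodes no
graph. -/
def reduction (q : ℕ) (x : (SExp × ℕ) × List (List (ℕ × ℕ))) : SExp × ℕ :=
  (bif isValid q x.1.1 then
    enc (graphColors (formulaVertices q x.1.1 x.1.2 x.2),
      graphEdges (formulaVertices q x.1.1 x.1.2 x.2))
    else .nil, numColors q x.1.2)

theorem mem_iff_reduction_mem (q : ℕ) (x : SExp) (k : ℕ) :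
    (x, k) ∈ WeightedCNFSat q ↔
      reduction q ((x, k), tuples (instructions q k) k) ∈ MultiColoredClique := by
  simp only [WeightedCNFSat, MultiColoredClique, reduction, Set.mem_ofPred_eq]
  cases hv : isValid q x with
  | false =>
    refine iff_of_false ?_ ?_
    · rintro ⟨n, F, rfl, hF, -⟩
      rw [isValid_encode F hF] at hv
      cases hv
    · rintro ⟨-, I, hI, -⟩
      cases hI
  | true =>
    set Vs := formulaVertices q x k (tuples (instructions q k) k) with hVs
    have hV : ∀ y ∈ Vs, y.1 < numColors q k := fun y hy => fst_lt_of_mem_vertices hy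
    simp only [cond_true]
    have hpos : 0 < numColors q k := by unfold numColors; omega
    have hvar : ∀ {n : ℕ} (F : CNFFormula n), ∀ C ∈ clauses F, ∀ l ∈ C, l.1 < n := by
      intro n F C hC l hl
      obtain ⟨C, hCF, rfl⟩ := mem_clauses.1 hC
      obtain ⟨l, -, rfl⟩ := List.mem_map.1 hl
      exact l.1.2
    have hlen : ∀ {n : ℕ} (F : CNFFormula n), (∀ C ∈ F, C.length ≤ q) →
        ∀ C ∈ clauses F, C.length ≤ q := by
      intro n F hF C hC
      obtain ⟨C, hCF, rfl⟩ := mem_clauses.1 hC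
      simpa using hF C hCF
    have hVsF : ∀ {n : ℕ} (F : CNFFormula n), x = F.encode →
        Vs = vertices n q k (clauses F) (tuples (instructions q k) k) := by
      rintro n F rfl
      rw [hVs, formulaVertices, toNat_left_encode, decodeClauses_encode]
    constructor
    · rintro ⟨n, F, hx, hF, S, hS, hsat⟩
      refine ⟨hpos, graphInstance hV, (encode_graphInstance hV).symm, ?_⟩
      rw [graphInstance_hasMultiColoredClique_iff, hVsF F hx]
      refine hasTransversal_of_finset (S := S.map Fin.valEmbedding) (hvar F) (hlen F hF) ?_
        (by simpa using hS) ?_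
      · intro v hv
        obtain ⟨v, -, rfl⟩ := Finset.mem_map.1 hv
        exact v.2
      · intro C hC
        obtain ⟨C, hCF, rfl⟩ := mem_clauses.1 hC
        obtain ⟨l, hl, hiff⟩ := hsat C hCF
        refine ⟨_, List.mem_map_of_mem hl, ?_⟩
        rw [← hiff]
        simp [← Fin.ext_iff]
    · rintro ⟨-, I, hI, hC⟩
      -- the tree determines the graph
      have hC' : (graphInstance hV).HasMultiColoredClique := by
        have h1 : I = graphInstance hV :=
          MCCInstance.encode_injective (hI.symm.trans (encode_graphInstance hV).symm)
        rwa [h1] at hC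
      rw [graphInstance_hasMultiColoredClique_iff] at hC'
      obtain ⟨n, F, rfl, hF⟩ := exists_encode_eq hv
      rw [hVsF F rfl] at hC'
      obtain ⟨S, hSn, hcard, hsat⟩ := exists_finset_of_hasTransversal (hvar F) (hlen F hF) hC'
      refine ⟨n, F, rfl, hF, Finset.univ.filter fun v => (v : ℕ) ∈ S, ?_, ?_⟩
      · rw [← hcard]
        refine Finset.card_bij (fun v _ => (v : ℕ)) (by simp) (fun v _ w _ h => Fin.ext h) ?_
        intro v hv
        exact ⟨⟨v, hSn v hv⟩, by simpa using hv, rfl⟩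
      · intro C hC
        obtain ⟨l, hl, hiff⟩ := hsat _ (mem_clauses.2 ⟨C, hC, rfl⟩)
        obtain ⟨l, hlC, rfl⟩ := List.mem_map.1 hl
        exact ⟨l, hlC, by simpa using hiff⟩

end CNFProgram

/-! ### Running time of the reduction from formulas -/

section
variable {α β : Type} [Enc α] [Enc β]

@[fun_prop]
theorem PolyTime.tuples {l : α → List β} (hl : PolyTime l) (q : ℕ) :
    PolyTime fun a => tuples (l a) q := by
  induction q with
  | zero => exact .const _
  | succ q ih =>
    exact hl.flatMap ((PolyTime.comp ih (f := fun x : α × β => x.1) (by fun_prop)).map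
      (by fun_prop))

theorem tuples_eq_foldl {β : Type} (l : List β) (m : ℕ) : tuples l m =
    (List.range m).foldl (fun s _ => l.flatMap fun b => s.map fun t => b :: t) [[]] := by
  induction m with
  | zero => rfl
  | succ m ih => rw [List.range_succ, List.foldl_append, ← ih]; rfl

theorem sz_map_cons_le (b : β) (s : List (List β)) :
    sz (s.map fun t => b :: t) + 1 ≤ sz s * (sz b + 2) := by
  induction s with
  | nil => simp
  | cons t s ih => simp only [List.map_cons, sz_cons]; nlinarith [sz_pos t, sz_pos b]

theorem sz_flatMap_map_cons_le (l : List β) (s : List (List β)) :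
    sz (l.flatMap fun b => s.map fun t => b :: t) ≤ 2 * sz l * sz s := by
  induction l with
  | nil => simp only [List.flatMap_nil, sz_nil]; nlinarith [sz_pos s]
  | cons b l ih =>
    have h1 := sz_map_cons_le b s
    have h2 := sz_append (s.map fun t => b :: t) (l.flatMap fun b => s.map fun t => b :: t)
    rw [List.flatMap_cons, sz_cons]
    nlinarith [sz_pos s, sz_pos b]

theorem sz_tuples_le (l : List β) (m : ℕ) : sz (tuples l m) ≤ (2 * sz l) ^ m * 3 := by
  induction m with
  | zero => simp [tuples]
  | succ m ih =>
    refine (sz_flatMap_map_cons_le l (tuples l m)).trans ?_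
    rw [pow_succ', mul_assoc ((2 * sz l))]
    gcongr

/-- The list of all lists of length `k` with entries from a list that depends on `k` can be computed
within a computable time bound. -/
theorem exists_runsIn_tuples {l : ℕ → List β} (hl : PolyTime l) :
    ∃ B : ℕ → ℕ, Computable B ∧ RunsIn (fun k => tuples (l k) k) B := by
  obtain ⟨Q, hQ⟩ := hl.polyBdd_sz
  obtain ⟨Tr, ⟨R, hR⟩, hr⟩ : PolyTime fun k : ℕ => List.range k := by fun_prop
  obtain ⟨Ts, ⟨P, hP⟩, hs⟩ : PolyTime fun x : ℕ × List (List β) × ℕ =>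
      (l x.1).flatMap fun b => x.2.1.map fun t => b :: t := by fun_prop
  let S : ℕ → ℕ := fun k => (2 * Q.eval (2 * k + 1)) ^ k * 3
  have hS : ∀ k m, m ≤ k → sz (tuples (l k) m) ≤ S k := by
    intro k m hm
    refine (sz_tuples_le _ _).trans ?_
    have h1 := hQ k
    have h2 := sz_pos (l k)
    rw [sz_nat] at h1
    have h3 : (2 * sz (l k)) ^ m ≤ (2 * sz (l k)) ^ k := Nat.pow_le_pow_right (by omega) hm
    have h4 : (2 * sz (l k)) ^ k ≤ (2 * Q.eval (2 * k + 1)) ^ k := by gcongr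
    exact Nat.mul_le_mul_right 3 (h3.trans h4)
  have hprefix : ∀ (k : ℕ) (l₁ l₂ : List ℕ), List.range k = l₁ ++ l₂ →
      ∃ m ≤ k, l₁ = List.range m := by
    intro k l₁ l₂ h
    have hlen : l₁.length ≤ k := by simpa using (congrArg List.length h).ge.trans' (by simp)
    refine ⟨l₁.length, hlen, ?_⟩
    have := congrArg (List.take l₁.length) h
    rw [List.take_left, List.take_range, min_eq_left hlen] at this
    exact this.symm
  have hrun := hr.foldl (RunsIn.const [[]]) hs (S := S)
    (D := fun k => P.eval (S k + 4 * k + 4)) ?_ ?_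
  · refine ⟨fun k => (R.eval (2 * k + 1) + 2) * (40 * (R.eval (2 * k + 1) + 3 * (2 * k + 2) +
      (2 * k + 1) + S k + P.eval (S k + 4 * k + 4) + 5)), ?_, ?_⟩
    · have hk : Computable fun k : ℕ => 2 * k + 1 :=
        ((Computable.const 2).mul_nat .id).add_nat (.const 1)
      have hRk := (Computable.polynomial_eval R).comp hk
      have hSk : Computable S :=
        (((Computable.const 2).mul_nat ((Computable.polynomial_eval Q).comp hk)).pow_nat
          .id).mul_nat (.const 3)
      have hPk := (Computable.polynomial_eval P).comp
        ((hSk.add_nat ((Computable.const 4).mul_nat .id)).add_nat (.const 4))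
      exact (hRk.add_nat (.const 2)).mul_nat ((Computable.const 40).mul_nat
        (((((hRk.add_nat ((Computable.const 3).mul_nat
          (((Computable.const 2).mul_nat .id).add_nat (.const 2)))).add_nat hk).add_nat
            hSk).add_nat hPk).add_nat (.const 5)))
    · have hfun : (fun k => tuples (l k) k) = fun k => (List.range k).foldl
          (fun s _ => (l k).flatMap fun b => s.map fun t => b :: t) [[]] :=
        funext fun k => tuples_eq_foldl (l k) k
      rw [hfun]
      refine hrun.mono fun k => ?_
      have h1 := hR k
      rw [sz_nat] at h1
      have h2 : sz ([[]] : List (List β)) * (sz k + 1) = 3 * (2 * k + 2) := by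
        rw [sz_nat, sz_cons, sz_nil, sz_nil]
      rw [h2, sz_nat]
      gcongr
  · intro k l₁ l₂ h
    obtain ⟨m, hm, rfl⟩ := hprefix k l₁ l₂ h
    rw [← tuples_eq_foldl (l k) m]
    exact hS k m hm
  · intro k l₁ b l₂ h
    obtain ⟨m, hm, hl₁⟩ := hprefix k l₁ _ h
    have hb : b < k := by rw [← List.mem_range, h]; simp
    refine (hP _).trans (P.eval_le_eval_of_le ?_)
    subst hl₁
    rw [← tuples_eq_foldl (l k) m]
    have := hS k m hm
    simp only [sz_pair, sz_nat]
    omega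

end

namespace CNFProgram

section
variable {α : Type} [Enc α] {n k : α → ℕ} {F : α → List (List (ℕ × Bool))}

@[fun_prop]
theorem polyTime_unhit {Y : α → List ℕ} {Z : α → List (ℕ × ℕ)} (hF : PolyTime F) (hY : PolyTime Y)
    (hZ : PolyTime Z) : PolyTime fun a => unhit (F a) (Y a) (Z a) := by
  unfold unhit; fun_prop

@[fun_prop]
theorem polyTime_positives {C : α → List (ℕ × Bool)} (hC : PolyTime C) :
    PolyTime fun a => positives (C a) := by
  unfold positives; fun_prop

/-- The search takes polynomial time, since each step adds one binding, whose value is a variable of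
the formula or `n`. -/
@[fun_prop]
theorem polyTime_search {Y : α → List ℕ} {is : α → List (ℕ × ℕ)} (hn : PolyTime n)
    (hF : PolyTime F) (hY : PolyTime Y) (his : PolyTime is) :
    PolyTime fun a => search (n a) (F a) (Y a) (is a) := by
  unfold search
  refine his.foldl_of_le_add (.const _) (by unfold searchStep; fun_prop)
    ((hn.polyBdd_sz.add hF.polyBdd_sz).add (his.polyBdd_sz.add (.const 2))) fun a Z i hi => ?_
  have h1 : sz i < sz (is a) := sz_lt_of_mem hi
  have hvar : ∀ w, (w, true) ∈ (unhit (F a) (Y a) Z).headD [] → sz w ≤ sz (F a) := by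
    intro w hw
    cases hun : unhit (F a) (Y a) Z with
    | nil => simp [hun] at hw
    | cons C T =>
      have hC : C ∈ F a := (mem_unhit.1 (hun ▸ List.mem_cons_self : C ∈ unhit (F a) (Y a) Z)).1
      rw [hun, List.headD_cons] at hw
      have h4 := sz_lt_of_mem hw
      have h5 := sz_lt_of_mem hC
      rw [sz_pair] at h4
      omega
  have h2 : sz ((positives ((unhit (F a) (Y a) Z).headD [])).getD i.1 (n a)) ≤
      sz (n a) + sz (F a) := by
    by_cases hlt : i.1 < (positives ((unhit (F a) (Y a) Z).headD [])).length
    · rw [List.getD_eq_getElem _ _ hlt]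
      have := hvar _ (mem_positives.1 (List.getElem_mem hlt))
      omega
    · rw [List.getD_eq_default _ _ (by omega)]
      omega
  obtain ⟨c, p⟩ := i
  rw [sz_pair] at h1
  rw [searchStep, sz_cons, sz_pair]
  dsimp only at h2 ⊢
  omega

@[fun_prop]
theorem polyTime_positionVertices (hn : PolyTime n) (hk : PolyTime k) :
    PolyTime fun a => positionVertices (n a) (k a) := by
  unfold positionVertices; fun_prop

@[fun_prop]
theorem polyTime_zipBindings (q : ℕ) {A Y : α → List ℕ} (hA : PolyTime A) (hY : PolyTime Y) :
    PolyTime fun a => zipBindings q (A a) (Y a) := by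
  unfold zipBindings; fun_prop

@[fun_prop]
theorem polyTime_positionTuples (q : ℕ) (hk : PolyTime k) :
    PolyTime fun a => positionTuples q (k a) := by
  unfold positionTuples; fun_prop

@[fun_prop]
theorem polyTime_vertices (q : ℕ) {σ : α → List (List (ℕ × ℕ))} (hn : PolyTime n)
    (hk : PolyTime k) (hF : PolyTime F) (hσ : PolyTime σ) :
    PolyTime fun a => vertices (n a) q (k a) (F a) (σ a) := by
  unfold vertices tupleVertices; fun_prop

@[fun_prop]
theorem polyTime_compatible {B B' : α → List (ℕ × ℕ)} (hB : PolyTime B) (hB' : PolyTime B') :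
    PolyTime fun a => compatible (B a) (B' a) := by
  unfold compatible; fun_prop

@[fun_prop]
theorem polyTime_graphColors {V : α → List (ℕ × List (ℕ × ℕ))} (hV : PolyTime V) :
    PolyTime fun a => graphColors (V a) := by
  unfold graphColors; fun_prop

@[fun_prop]
theorem polyTime_graphEdges {V : α → List (ℕ × List (ℕ × ℕ))} (hV : PolyTime V) :
    PolyTime fun a => graphEdges (V a) := by
  unfold graphEdges isEdge; fun_prop

@[fun_prop]
theorem polyTime_isValid (q : ℕ) {x : α → SExp} (hx : PolyTime x) :
    PolyTime fun a => isValid q (x a) := by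
  unfold isValid; fun_prop

@[fun_prop]
theorem polyTime_decodeClauses {x : α → SExp} (hx : PolyTime x) :
    PolyTime fun a => decodeClauses (x a) := by
  unfold decodeClauses; fun_prop

end

theorem polyTime_reduction (q : ℕ) : PolyTime (reduction q) := by
  unfold reduction formulaVertices numColors; fun_prop

theorem polyTime_instructions (q : ℕ) : PolyTime fun k => instructions q k := by
  unfold instructions; fun_prop

end CNFProgram

theorem fptReduces_weightedCNFSat_multiColoredClique (q : ℕ) :
    FPTReduces (WeightedCNFSat q) MultiColoredClique := by
  obtain ⟨B, hB, hrun⟩ := exists_runsIn_tuples (CNFProgram.polyTime_instructions q)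
  refine .of_polyTime hrun hB (CNFProgram.polyTime_reduction q)
    (((Computable.id.add_nat (.const 1))).add_nat
      ((Computable.id.add_nat (.const 1)).pow_nat (.const q))) (fun x k => ?_)
    (CNFProgram.mem_iff_reduction_mem q)
  simp [CNFProgram.reduction, CNFProgram.numColors, CNFProgram.positionTuples, length_tuples]

theorem mainTheorem5 :
    W1Hard MinSumSP ∧
      PolyReducesWithParam MultiColoredClique MinSumSP (fun h => h.choose 2 + h) := by
  refine ⟨fun P hP => ?_, polyReduces_multiColoredClique_minSumSP⟩
  obtain ⟨q, hq⟩ := hP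
  exact hq.trans ((fptReduces_weightedCNFSat_multiColoredClique q).trans
    (polyReduces_multiColoredClique_minSumSP.fptReduces Computable.choose_two_add_id))
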